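/- All graphs are finite, undirected and simple. A connected graph $\Gamma$ with diameter $D$ is distance-regular if there are integers $b_i, c_i$ ($0\le i\le D$, $b_D=c_0=0$) such that for any two vertices $x,y$ at distance $i$ there are exactly $c_i$ neighbours of $y$ at distance $i-1$ from $x$ and exactly $b_i$ neighbours of $y$ at distance $i+1$ from $x$. Its valency is $k=b_0$, its intersection array is $\{b_0,\dots,b_{D-1};c_1,\dots,c_D\}$, and $k_2$ denotes the number of vertices at distance two from a vertex (this number does not depend on the vertex). A Taylor graph is a distance-regular graph with intersection array $\{k,\mu,1;1,\mu,k\}$. For every real $\varepsilon>0$ there exists a real number $\kappa=\kappa(\varepsilon)\ge 3$ with the following property: if $\Gamma$ is a distance-regular graph with diameter $D\ge 3$, valency $k\ge\kappa(\varepsilon)$ and $k_2\le(2-\varepsilon)k$, then $D=3$ and $\Gamma$ is bipartite or a Taylor graph. Moreover, for every $\varepsilon>0$ the number $$\kappa=\frac{(40/\varepsilon^2-1)(40/\varepsilon^2+2)}{2}$$ has this property, and it is at least $3$ whenever $\varepsilon\le 2$ (for $\varepsilon> 2$ no graph of positive valency satisfies $k_2\le(2-\varepsilon)k$). -/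

import Mathlib

universe u

namespace SimpleGraph

/-- `Γ_i(x)`: the set of vertices at distance exactly `i` from `x`. -/
def distSphere {V : Type u} (G : SimpleGraph V) (x : V) (i : ℕ) : Set V :=
  {w | G.dist x w = i}

/-- `G` is a distance-regular graph of diameter `D` with intersection array
`{b 0, …, b (D - 1); c 1, …, c D}`: it is connected, has diameter `D`, and for any two vertices
`x`, `y` at distance `i` there are exactly `c i` neighbours of `y` at distance `i - 1` from `x`
(none if `i = 0`) and exactly `b i` neighbours of `y` at distance `i + 1` from `x`, where
`b D = c 0 = 0`. Its valency is `b 0`. The values of `b` and `c` beyond `D` play no role. -/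
structure HasIntersectionArray {V : Type u} (G : SimpleGraph V) (D : ℕ) (b c : ℕ → ℕ) :
    Prop where
  connected : G.Connected
  diam_eq : G.diam = D
  b_last : b D = 0
  c_zero : c 0 = 0
  c_eq : ∀ (i : ℕ) (x y : V), G.dist x y = i →
    {w | G.Adj y w ∧ G.dist x w + 1 = i}.ncard = c i
  b_eq : ∀ (i : ℕ) (x y : V), G.dist x y = i →
    {w | G.Adj y w ∧ G.dist x w = i + 1}.ncard = b i

/-- A Taylor graph: a distance-regular graph with intersection array `{k, μ, 1; 1, μ, k}`. -/
def IsTaylor {V : Type u} (G : SimpleGraph V) : Prop :=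
  ∃ (k μ : ℕ) (b c : ℕ → ℕ), G.HasIntersectionArray 3 b c ∧
    b 0 = k ∧ b 1 = μ ∧ b 2 = 1 ∧ c 1 = 1 ∧ c 2 = μ ∧ c 3 = k

/-- `κ` is a valency threshold for `ε`: every finite distance-regular graph with diameter
`D ≥ 3`, valency `k = b 0 ≥ κ` and `k₂ ≤ (2 - ε) k` (where `k₂` is the number of vertices at
distance two from a vertex `x`, which does not depend on `x`) has `D = 3` and is
bipartite or a Taylor graph. -/
def IsValencyThreshold (ε κ : ℝ) : Prop :=
  ∀ (V : Type u) [Finite V] (G : SimpleGraph V) (D : ℕ) (b c : ℕ → ℕ),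
    G.HasIntersectionArray D b c → 3 ≤ D → κ ≤ (b 0 : ℝ) →
    ∀ x : V, ((G.distSphere x 2).ncard : ℝ) ≤ (2 - ε) * (b 0 : ℝ) →
      D = 3 ∧ (G.IsBipartite ∨ G.IsTaylor)

end SimpleGraph

/-!
# Distance-regular graphs with few vertices at distance two

Let `k = b 0` and `a i = k - b i - c i`. As `k₂ c₂ = k b₁`, the hypothesis `k₂ ≤ (2 - ε) k` says
`b₁ ≤ (2 - ε) c₂`; since `c₂ ≤ b₁`, it forces `ε ≤ 1`, and the bound on the valency then gives
`k ε⁴ ≥ 800`.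

*Diameter at least four.* The neighbourhoods of two vertices far apart yield a non-trivial
eigenvalue `θ ≥ a₁` (`exists_val_ge`). The projection onto its eigenspace has entries depending only
on the distance. Restricted to the neighbourhood of a vertex and to vectors with sum zero, it is a
combination of the identity and of the adjacency matrix, and its positivity says that the
neighbourhood graph behaves quasirandomly from one side: a set of `n` neighbours spans at least
about `n² a₁ / k` ordered adjacent pairs (`sq_card_mul_le`). This is applied to two kinds of sets.
For the common neighbours of `y` with two vertices `x`, `x'` at distance two from `y` and four from each
other, between which there are no edges, it gives roughly `2 a₁ ≤ k` and, on average over such pairs,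
a lower bound for the number of edges among the common neighbours of `y` and a vertex at distance two
(`card_mul_le_sum_spanCount`). For the common neighbours of the ends of an edge it gives an upper
bound for the same number, because edges in the neighbourhood of `y` have a fixed number of common
neighbours in total (`sum_spanCount`). The bounds are incompatible for `2 c₂ ≥ (1 + ε / 2) b₁`
and large `k` (`diam_lt_four`).

*Diameter three.* In a non-bipartite graph, an eigenvalue other than `k` and `0` has multiplicity at
least `√k` (`valency_le_multiplicity_sq`). There are three non-trivial eigenvalues, so comparison
with the trace `∑ θ² = |V| k` bounds the sum of their squares by `ε² k² / 28` times a factor that is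
about `k₂ / k`, plus a contribution of the vertices at distance three. By the characteristic
polynomial of the intersection matrix that sum is
`(a₁ - c₂)² + (a₃ - b₂)² + 2 b₂ c₂ + 2 (k - c₂)` (`mul_sum_sq_le`), so that `a₁ - c₂`, `a₃` and `b₂`
are small compared with `k`. On the other hand, counting paths of length two between vertices at
distance three from `x` gives a bound (`c_three_mul_le`) which under these conditions fails, unless
`a₃ = 0` and `b₂ = 1`. In that case there is a single vertex at distance three from `x`, and the
graph is a Taylor graph (`isTaylor_of_not_isBipartite`).
-/

open Finset
open scoped Matrix

set_option linter.unusedSectionVars false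

/-! ### Counting in distance-regular graphs -/

namespace SimpleGraph

variable {V : Type u} [Fintype V] [DecidableEq V] {G : SimpleGraph V} [DecidableRel G.Adj]
  {D : ℕ} {b c : ℕ → ℕ}

namespace HasIntersectionArray

theorem dist_le (h : G.HasIntersectionArray D b c) (x y : V) : G.dist x y ≤ D := by
  have : Nonempty V := ⟨x⟩
  rw [← h.diam_eq]
  exact dist_le_diam (connected_iff_ediam_ne_top.mp h.connected)

theorem dist_triangle (h : G.HasIntersectionArray D b c) (x y z : V) :
    G.dist x z ≤ G.dist x y + G.dist y z := h.connected.dist_triangle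

theorem dist_adj_le (h : G.HasIntersectionArray D b c) (x : V) {y w : V} (hw : G.Adj y w) :
    G.dist x w ≤ G.dist x y + 1 ∧ G.dist x y ≤ G.dist x w + 1 := by
  have h1 := h.dist_triangle x y w
  have h2 := h.dist_triangle x w y
  rw [dist_eq_one_iff_adj.mpr hw] at h1
  rw [dist_eq_one_iff_adj.mpr hw.symm] at h2
  exact ⟨h1, h2⟩

theorem card_c (h : G.HasIntersectionArray D b c) {i : ℕ} {x y : V} (hd : G.dist x y = i) :
    #{w | G.Adj y w ∧ G.dist x w + 1 = i} = c i := by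
  rw [← h.c_eq i x y hd, Set.ncard_eq_toFinset_card']
  congr 1
  ext; simp

theorem card_b (h : G.HasIntersectionArray D b c) {i : ℕ} {x y : V} (hd : G.dist x y = i) :
    #{w | G.Adj y w ∧ G.dist x w = i + 1} = b i := by
  rw [← h.b_eq i x y hd, Set.ncard_eq_toFinset_card']
  congr 1
  ext; simp

theorem card_adj (h : G.HasIntersectionArray D b c) (x : V) : #{w | G.Adj x w} = b 0 := by
  rw [← h.card_b (dist_self (G := G) (v := x))]
  congr 1
  ext w; simp

/-- A vertex `y` at distance `i` from `x` has exactly `a i = b 0 - b i - c i` neighbours at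
distance `i` from `x`. -/
theorem card_a (h : G.HasIntersectionArray D b c) {i : ℕ} {x y : V} (hd : G.dist x y = i) :
    #{w | G.Adj y w ∧ G.dist x w = i} + b i + c i = b 0 := by
  rw [← h.card_adj y, ← h.card_b hd, ← h.card_c hd, ← card_union_of_disjoint,
    ← card_union_of_disjoint]
  · congr 1
    ext w
    simp only [mem_union, mem_filter, mem_univ, true_and]
    constructor
    · tauto
    · intro hw
      have := h.dist_adj_le x hw
      simp only [hw, true_and]
      omega
  · rw [Finset.disjoint_left]
    intro w
    simp only [mem_union, mem_filter, mem_univ, true_and]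
    omega
  · rw [Finset.disjoint_left]
    intro w
    simp only [mem_filter, mem_univ, true_and]
    omega

theorem b_add_c_le (h : G.HasIntersectionArray D b c) {i : ℕ} {x y : V} (hd : G.dist x y = i) :
    b i + c i ≤ b 0 := by
  have := h.card_a hd
  omega

/-- Summing a function of the distance to `x` over the neighbours of a vertex at distance `i`
from `x`. For `i = 0` the term `g (i - 1)` is harmless, because `c 0 = 0`. -/
theorem sum_adj (h : G.HasIntersectionArray D b c) {i : ℕ} {x y : V} (hd : G.dist x y = i)
    (g : ℕ → ℝ) : ∑ w with G.Adj y w, g (G.dist x w) =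
      c i * g (i - 1) + ((b 0 : ℝ) - b i - c i) * g i + b i * g (i + 1) := by
  have key : ∀ w, G.Adj y w → g (G.dist x w) =
      (if G.dist x w + 1 = i then g (i - 1) else 0) + (if G.dist x w = i then g i else 0)
        + (if G.dist x w = i + 1 then g (i + 1) else 0) := by
    intro w hw
    have := h.dist_adj_le x hw
    obtain h1 | h1 | h1 : G.dist x w + 1 = i ∨ G.dist x w = i ∨ G.dist x w = i + 1 := by omega
    · have h2 : G.dist x w = i - 1 := by omega
      rw [if_pos h1, if_neg (by omega), if_neg (by omega), h2]; ring
    · rw [if_neg (by omega), if_pos h1, if_neg (by omega), h1]; ring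
    · rw [if_neg (by omega), if_neg (by omega), if_pos h1, h1]; ring
  rw [sum_congr rfl (fun w hw => key w (by simpa using hw)), sum_add_distrib, sum_add_distrib]
  simp only [← sum_filter, filter_filter, sum_const, nsmul_eq_mul]
  rw [h.card_c hd, h.card_b hd]
  have := h.card_a hd
  have h3 : (#{w | G.Adj y w ∧ G.dist x w = i} : ℝ) = (b 0 : ℝ) - b i - c i := by
    rw [← this]; push_cast; ring
  rw [h3]

theorem exists_prev (h : G.HasIntersectionArray D b c) {x y : V} {i : ℕ}
    (hd : G.dist x y = i + 1) : ∃ w, G.Adj y w ∧ G.dist x w = i := by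
  obtain ⟨p, hp⟩ := h.connected.exists_walk_length_eq_dist y x
  cases p with
  | nil => simp at hd
  | cons hadj q =>
    rename_i w
    refine ⟨w, hadj, ?_⟩
    have h1 := SimpleGraph.dist_le q
    have h2 := h.dist_adj_le x hadj
    rw [dist_comm] at h1
    rw [Walk.length_cons, dist_comm, hd] at hp
    omega

theorem exists_dist_pair (h : G.HasIntersectionArray D b c) {i : ℕ} (hi : i ≤ D) :
    ∃ x y, G.dist x y = i := by
  have : Nonempty V := h.connected.nonempty
  obtain ⟨x, y, hxy⟩ := G.exists_dist_eq_diam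
  rw [h.diam_eq] at hxy
  obtain ⟨j, rfl⟩ := Nat.exists_eq_add_of_le hi
  clear hi
  have : ∀ j y, G.dist x y = i + j → ∃ x y, G.dist x y = i := by
    intro j
    induction j with
    | zero => intro y hy; exact ⟨x, y, hy⟩
    | succ j ih =>
      intro y hy
      obtain ⟨w, -, hw⟩ := h.exists_prev (i := i + j) hy
      exact ih w hw
  exact this j y hxy

theorem b_pos (h : G.HasIntersectionArray D b c) {i : ℕ} (hi : i < D) : 0 < b i := by
  obtain ⟨x, y, hxy⟩ := h.exists_dist_pair (i := i + 1) hi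
  obtain ⟨w, hw, hxw⟩ := h.exists_prev hxy
  rw [← h.card_b hxw, card_pos]
  exact ⟨y, by simp [hw.symm, hxy]⟩

theorem c_pos (h : G.HasIntersectionArray D b c) {i : ℕ} (hi : i + 1 ≤ D) : 0 < c (i + 1) := by
  obtain ⟨x, y, hxy⟩ := h.exists_dist_pair hi
  obtain ⟨w, hw, hxw⟩ := h.exists_prev hxy
  rw [← h.card_c hxy, card_pos]
  exact ⟨w, by simp [hw, hxw]⟩

theorem c_one (h : G.HasIntersectionArray D b c) (hD : 1 ≤ D) : c 1 = 1 := by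
  obtain ⟨x, y, hxy⟩ := h.exists_dist_pair hD
  rw [← h.card_c hxy, card_eq_one]
  refine ⟨x, ?_⟩
  ext w
  simp only [mem_filter, mem_univ, true_and, mem_singleton, add_eq_right,
    h.connected.dist_eq_zero_iff]
  constructor
  · rintro ⟨-, rfl⟩; rfl
  · rintro rfl; exact ⟨(dist_eq_one_iff_adj.mp hxy).symm, rfl⟩

theorem exists_next (h : G.HasIntersectionArray D b c) {x y : V} {i : ℕ} (hd : G.dist x y = i)
    (hi : i < D) : ∃ w, G.Adj y w ∧ G.dist x w = i + 1 := by
  have := h.b_pos hi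
  rw [← h.card_b hd, card_pos] at this
  obtain ⟨w, hw⟩ := this
  exact ⟨w, by simpa using hw⟩

theorem exists_dist (h : G.HasIntersectionArray D b c) (x : V) {i : ℕ} (hi : i ≤ D) :
    ∃ y, G.dist x y = i := by
  induction i with
  | zero => exact ⟨x, dist_self⟩
  | succ i ih =>
    obtain ⟨y, hy⟩ := ih (by omega)
    obtain ⟨w, -, hw⟩ := h.exists_next hy hi
    exact ⟨w, hw⟩

theorem exists_between (h : G.HasIntersectionArray D b c) {i j : ℕ} {x z : V}
    (hd : G.dist x z = i + j) : ∃ y, G.dist x y = i ∧ G.dist z y = j := by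
  induction j generalizing z with
  | zero => exact ⟨z, hd, dist_self⟩
  | succ j ih =>
    obtain ⟨w, hw, hxw⟩ := h.exists_prev (i := i + j) hd
    obtain ⟨y, hy, hwy⟩ := ih hxw
    refine ⟨y, hy, ?_⟩
    have h1 := h.dist_triangle x y z
    have h2 := (h.dist_adj_le y hw).2
    rw [G.dist_comm (u := y) (v := w), G.dist_comm (u := y) (v := z)] at h2
    rw [G.dist_comm (u := y) (v := z)] at h1
    omega

/-- For `y` on a geodesic from `x` to `z`, the neighbours of `y` closer to `x` are farther from `z`.
-/
theorem c_le_b (h : G.HasIntersectionArray D b c) {i j : ℕ} (hij : i + j ≤ D) : c i ≤ b j := by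
  obtain ⟨x, z, hxz⟩ := h.exists_dist_pair hij
  obtain ⟨y, hy, hzy⟩ := h.exists_between hxz
  rw [← h.card_c hy, ← h.card_b hzy]
  apply card_le_card
  intro w
  simp only [mem_filter, mem_univ, true_and]
  rintro ⟨hw, hxw⟩
  refine ⟨hw, ?_⟩
  have h1 := h.dist_triangle x w z
  have h2 := h.dist_adj_le z hw
  rw [G.dist_comm (u := w) (v := z)] at h1
  omega

/-- For `y` on a geodesic from `x` to `z`, next to `x`, the neighbours of `z` closer to `y` are closer
to `x`. -/
theorem c_le_c (h : G.HasIntersectionArray D b c) {i : ℕ} (hi : i + 1 ≤ D) : c i ≤ c (i + 1) := by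
  obtain ⟨x, z, hxz⟩ := h.exists_dist_pair hi
  obtain ⟨x', hx', hz⟩ := h.exists_between (i := 1) (j := i) (x := x) (z := z) (by omega)
  rw [G.dist_comm] at hz
  rw [← h.card_c hz, ← h.card_c hxz]
  apply card_le_card
  intro w
  simp only [mem_filter, mem_univ, true_and]
  rintro ⟨hw, hxw⟩
  refine ⟨hw, ?_⟩
  have h1 := h.dist_triangle x x' w
  have h2 := h.dist_adj_le x hw
  omega

theorem card_sphere_mul (h : G.HasIntersectionArray D b c) (x : V) (i : ℕ) :
    #{y | G.dist x y = i} * b i = #{y | G.dist x y = i + 1} * c (i + 1) := by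
  have := sum_card_bipartiteAbove_eq_sum_card_bipartiteBelow (s := {y | G.dist x y = i})
    (t := {y | G.dist x y = i + 1}) (fun y z => G.Adj y z)
  rw [sum_const_nat (m := b i), sum_const_nat (m := c (i + 1))] at this
  · exact this
  · intro z hz
    rw [← h.card_c (by simpa using hz)]
    congr 1
    ext w
    simp only [mem_bipartiteBelow, mem_filter, mem_univ, true_and, G.adj_comm w z,
      add_left_inj]
    tauto
  · intro z hz
    rw [← h.card_b (by simpa using hz)]
    congr 1
    ext w
    simp only [mem_bipartiteAbove, mem_filter, mem_univ, true_and]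
    tauto

theorem card_sphere_zero (h : G.HasIntersectionArray D b c) (x : V) :
    #{y | G.dist x y = 0} = 1 := by
  rw [card_eq_one]
  exact ⟨x, by ext w; simp [h.connected.dist_eq_zero_iff, eq_comm]⟩

theorem card_sphere_one (h : G.HasIntersectionArray D b c) (x : V) :
    #{y | G.dist x y = 1} = b 0 := by
  rw [← h.card_adj x]
  congr 1
  ext; simp

/-- The vertices `z` reached from `x` by passing through `y` and moving two further steps away. -/
theorem card_two_step_mul (h : G.HasIntersectionArray D b c) {i : ℕ} {x y : V}
    (hd : G.dist x y = i) :
    #{z | G.dist y z = 2 ∧ G.dist x z = i + 2} * c 2 = b i * b (i + 1) := by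
  have := sum_card_bipartiteAbove_eq_sum_card_bipartiteBelow
    (s := {w | G.Adj y w ∧ G.dist x w = i + 1})
    (t := {z | G.dist y z = 2 ∧ G.dist x z = i + 2}) (fun y z => G.Adj y z)
  rw [sum_const_nat (m := b (i + 1)), sum_const_nat (m := c 2), h.card_b hd] at this
  · exact this.symm
  · intro z hz
    simp only [mem_filter, mem_univ, true_and] at hz
    rw [← h.card_c hz.1]
    congr 1
    ext w
    simp only [mem_bipartiteBelow, mem_filter, mem_univ, true_and, G.adj_comm w z,
      Nat.reduceEqDiff, dist_eq_one_iff_adj]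
    constructor
    · tauto
    · rintro ⟨hzw, hyw⟩
      have h1 := h.dist_adj_le x hyw
      have h2 := h.dist_adj_le x hzw
      exact ⟨⟨hyw, by omega⟩, hzw⟩
  · intro w hw
    simp only [mem_filter, mem_univ, true_and] at hw
    rw [← h.card_b hw.2]
    congr 1
    ext z
    simp only [mem_bipartiteAbove, mem_filter, mem_univ, true_and]
    constructor
    · tauto
    · rintro ⟨hwz, hxz⟩
      have h1 := h.dist_triangle x y z
      have h2 := h.dist_adj_le y hwz
      rw [dist_eq_one_iff_adj.mpr hw.1] at h2
      exact ⟨⟨by omega, hxz⟩, hwz⟩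

end HasIntersectionArray
end SimpleGraph

/-! ### Eigenvectors and projections onto eigenspaces -/

/-- An orthonormal basis of eigenvectors `vec i` of a real square matrix, with eigenvalues `val i`,
written in coordinates: `orthonormal` and `complete` say that the matrix with rows `vec i` is
orthogonal. -/
structure EigenFrame {V : Type*} [Fintype V] [DecidableEq V] (A : Matrix V V ℝ) where
  val : V → ℝ
  vec : V → V → ℝ
  mulVec_vec : ∀ i, A *ᵥ vec i = val i • vec i
  orthonormal : ∀ i j, ∑ x, vec i x * vec j x = if i = j then 1 else 0
  complete : ∀ x y, ∑ i, vec i x * vec i y = if x = y then 1 else 0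

namespace EigenFrame

variable {V : Type*} [Fintype V] [DecidableEq V] {A : Matrix V V ℝ}

theorem nonempty_of_isHermitian (hA : A.IsHermitian) : Nonempty (EigenFrame A) := by
  refine ⟨⟨hA.eigenvalues, fun i => hA.eigenvectorBasis i, hA.mulVec_eigenvectorBasis, ?_, ?_⟩⟩
  · intro i j
    have := orthonormal_iff_ite.mp hA.eigenvectorBasis.orthonormal j i
    simp only [PiLp.inner_apply, RCLike.inner_apply, conj_trivial] at this
    rw [this]
    simp [eq_comm]
  · intro x y
    have := hA.eigenvectorBasis.sum_inner_mul_inner (EuclideanSpace.single x 1)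
      (EuclideanSpace.single y 1)
    simpa [EuclideanSpace.inner_single_left, EuclideanSpace.inner_single_right,
      Pi.single_apply, eq_comm] using this

variable (F : EigenFrame A)

/-- The orthogonal projection onto the eigenspace of `θ` (zero if `θ` is not an eigenvalue). -/
noncomputable def idem (θ : ℝ) : Matrix V V ℝ :=
  Matrix.of fun x y => ∑ i with F.val i = θ, F.vec i x * F.vec i y

theorem idem_apply (θ : ℝ) (x y : V) :
    F.idem θ x y = ∑ i with F.val i = θ, F.vec i x * F.vec i y := rfl

theorem apply_eq_sum (M : Matrix V V ℝ) (x y : V) :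
    M x y = ∑ i, (M *ᵥ F.vec i) x * F.vec i y := by
  simp only [Matrix.mulVec, dotProduct, sum_mul]
  rw [sum_comm]
  simp_rw [mul_assoc, ← mul_sum, F.complete]
  simp

theorem aeval_mulVec (p : Polynomial ℝ) (i : V) :
    (Polynomial.aeval A p) *ᵥ F.vec i = p.eval (F.val i) • F.vec i := by
  induction p using Polynomial.induction_on' with
  | add p q hp hq => rw [map_add, Matrix.add_mulVec, hp, hq, Polynomial.eval_add, add_smul]
  | monomial n a =>
    rw [Polynomial.aeval_monomial, Polynomial.eval_monomial, ← Matrix.mulVec_mulVec,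
      Algebra.algebraMap_eq_smul_one, Matrix.smul_mulVec, Matrix.one_mulVec, mul_smul]
    congr 1
    induction n with
    | zero => simp
    | succ n ih =>
      rw [pow_succ, ← Matrix.mulVec_mulVec, F.mulVec_vec, Matrix.mulVec_smul, ih, smul_smul,
        pow_succ, mul_comm]

theorem aeval_apply (p : Polynomial ℝ) (x y : V) :
    Polynomial.aeval A p x y = ∑ i, p.eval (F.val i) * (F.vec i x * F.vec i y) := by
  rw [F.apply_eq_sum (Polynomial.aeval A p)]
  simp [F.aeval_mulVec, mul_assoc]

/-- The projection onto an eigenspace is a polynomial in the matrix, by interpolation on the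
spectrum. -/
theorem exists_aeval_eq_idem (θ : ℝ) : ∃ p : Polynomial ℝ, Polynomial.aeval A p = F.idem θ := by
  refine ⟨Lagrange.interpolate (univ.image F.val) id (fun t => if t = θ then 1 else 0), ?_⟩
  ext x y
  rw [F.aeval_apply, F.idem_apply, sum_filter]
  refine sum_congr rfl fun i _ => ?_
  have := Lagrange.eval_interpolate_at_node (s := univ.image F.val) (v := id)
    (fun t : ℝ => if t = θ then (1 : ℝ) else 0) (Set.injOn_id _) (i := F.val i) (by simp)
  simp only [id] at this
  rw [this]
  split_ifs <;> simp

theorem mul_idem (θ : ℝ) : A * F.idem θ = θ • F.idem θ := by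
  ext x y
  simp only [Matrix.mul_apply, Matrix.smul_apply, F.idem_apply, smul_eq_mul, mul_sum]
  rw [sum_comm]
  refine sum_congr rfl fun i hi => ?_
  have := congrFun (F.mulVec_vec i) x
  simp only [Matrix.mulVec, dotProduct, Pi.smul_apply, smul_eq_mul, (mem_filter.mp hi).2] at this
  rw [← mul_assoc, ← this, sum_mul]
  exact sum_congr rfl fun z _ => by ring

theorem sum_mul_idem (θ : ℝ) (f : V → ℝ) :
    ∑ x, ∑ y, f x * f y * F.idem θ x y = ∑ i with F.val i = θ, (∑ x, f x * F.vec i x) ^ 2 := by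
  simp only [F.idem_apply, mul_sum, sq, sum_mul]
  rw [sum_congr rfl fun x _ => sum_comm, sum_comm]
  refine sum_congr rfl fun i _ => ?_
  rw [sum_comm]
  exact sum_congr rfl fun x _ => sum_congr rfl fun y _ => by ring

theorem sum_mul_idem_nonneg (θ : ℝ) (f : V → ℝ) :
    0 ≤ ∑ x, ∑ y, f x * f y * F.idem θ x y := by
  rw [F.sum_mul_idem]
  positivity

theorem sum_sub_sq (θ : ℝ) (x y : V) :
    ∑ i with F.val i = θ, (F.vec i x - F.vec i y) ^ 2 =
      F.idem θ x x + F.idem θ y y - 2 * F.idem θ x y := by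
  simp only [F.idem_apply, mul_sum, ← sum_add_distrib, ← sum_sub_distrib]
  exact sum_congr rfl fun i _ => by ring

theorem sum_add_sq (θ : ℝ) (x y : V) :
    ∑ i with F.val i = θ, (F.vec i x + F.vec i y) ^ 2 =
      F.idem θ x x + F.idem θ y y + 2 * F.idem θ x y := by
  simp only [F.idem_apply, mul_sum, ← sum_add_distrib]
  exact sum_congr rfl fun i _ => by ring

theorem sum_sq_eq (f : V → ℝ) : ∑ x, f x ^ 2 = ∑ i, (∑ x, f x * F.vec i x) ^ 2 := by
  have : ∀ i, (∑ x, f x * F.vec i x) ^ 2 = ∑ x, ∑ y, f x * f y * (F.vec i x * F.vec i y) := by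
    intro i
    rw [sq, sum_mul_sum]
    exact sum_congr rfl fun x _ => sum_congr rfl fun y _ => by ring
  simp_rw [this]
  rw [sum_comm]
  refine sum_congr rfl fun x _ => ?_
  rw [sum_comm]
  simp_rw [← mul_sum, F.complete]
  simp [sq]

theorem quadratic_eq (f : V → ℝ) :
    ∑ x, ∑ y, f x * f y * A x y = ∑ i, F.val i * (∑ x, f x * F.vec i x) ^ 2 := by
  have : ∀ i, F.val i * (∑ x, f x * F.vec i x) ^ 2 =
      ∑ x, ∑ y, f x * f y * ((F.val i * F.vec i x) * F.vec i y) := by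
    intro i
    rw [sq, sum_mul_sum, mul_sum]
    refine sum_congr rfl fun x _ => ?_
    rw [mul_sum]
    exact sum_congr rfl fun y _ => by ring
  simp_rw [this]
  symm
  rw [sum_comm]
  refine sum_congr rfl fun x _ => ?_
  rw [sum_comm]
  refine sum_congr rfl fun y _ => ?_
  rw [← mul_sum, F.apply_eq_sum A x y, mul_sum, mul_sum]
  simp [F.mulVec_vec]

theorem exists_vec_ne_zero (i : V) : ∃ x, F.vec i x ≠ 0 := by
  by_contra! h
  have := F.orthonormal i i
  simp [h] at this

/-- Every eigenvalue of `A` occurs among the `F.val i`, because an eigenvector for any other number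
would be orthogonal to all `F.vec i`. -/
theorem exists_val_eq (hA : A.IsHermitian) {θ : ℝ} {f : V → ℝ} (hf : A *ᵥ f = θ • f)
    (h0 : f ≠ 0) : ∃ i, F.val i = θ := by
  by_contra! hne
  have key : ∀ i, ∑ x, f x * F.vec i x = 0 := by
    intro i
    have h1 : f ⬝ᵥ (A *ᵥ F.vec i) = (A *ᵥ f) ⬝ᵥ F.vec i := by
      have hAT : Aᵀ = A := by rw [← Matrix.conjTranspose_eq_transpose_of_trivial]; exact hA
      rw [Matrix.dotProduct_mulVec, ← Matrix.mulVec_transpose, hAT]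
    rw [F.mulVec_vec, hf, dotProduct_smul, smul_dotProduct, smul_eq_mul, smul_eq_mul] at h1
    have h2 : (F.val i - θ) * (f ⬝ᵥ F.vec i) = 0 := by linarith
    exact (mul_eq_zero.mp h2).resolve_left (sub_ne_zero.mpr (hne i))
  have h3 := F.sum_sq_eq f
  simp only [key] at h3
  apply h0
  ext x
  have := (sum_eq_zero_iff_of_nonneg (fun x _ => sq_nonneg (f x))).mp (by simpa using h3) x
    (mem_univ x)
  simpa using this

end EigenFrame

namespace SimpleGraph
namespace HasIntersectionArray

variable {V : Type u} [Fintype V] [DecidableEq V] {G : SimpleGraph V} [DecidableRel G.Adj]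
  {D : ℕ} {b c : ℕ → ℕ}

/-- The entries of a polynomial in the adjacency matrix of a distance-regular graph depend only on
the distance. -/
theorem exists_aeval_adjMatrix_eq (h : G.HasIntersectionArray D b c) (p : Polynomial ℝ) :
    ∃ g : ℕ → ℝ, ∀ x y, Polynomial.aeval (G.adjMatrix ℝ) p x y = g (G.dist x y) := by
  have hone : ∀ x y, (1 : Matrix V V ℝ) x y = if G.dist x y = 0 then 1 else 0 := by
    intro x y
    simp [Matrix.one_apply, h.connected.dist_eq_zero_iff]
  have hpow : ∀ n : ℕ, ∃ g : ℕ → ℝ, ∀ x y, (G.adjMatrix ℝ ^ n) x y = g (G.dist x y) := by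
    intro n
    induction n with
    | zero => exact ⟨fun i => if i = 0 then 1 else 0, by simpa using hone⟩
    | succ n ih =>
      obtain ⟨g, hg⟩ := ih
      refine ⟨fun i => c i * g (i - 1) + ((b 0 : ℝ) - b i - c i) * g i + b i * g (i + 1), ?_⟩
      intro x y
      have h1 := h.sum_adj (G.dist_comm (u := y) (v := x)) g
      rw [pow_succ', adjMatrix_mul_apply, neighborFinset_eq_filter]
      refine Eq.trans ?_ h1
      exact sum_congr rfl fun w _ => by rw [hg, dist_comm]
  induction p using Polynomial.induction_on' with
  | add p q hp hq =>
    obtain ⟨g, hg⟩ := hp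
    obtain ⟨g', hg'⟩ := hq
    exact ⟨g + g', fun x y => by simp [hg, hg']⟩
  | monomial n a =>
    obtain ⟨g, hg⟩ := hpow n
    refine ⟨a • g, fun x y => ?_⟩
    rw [Polynomial.aeval_monomial, Algebra.algebraMap_eq_smul_one, Matrix.smul_mul, one_mul]
    simp [hg]

variable (F : EigenFrame (G.adjMatrix ℝ))

/-- The projection onto an eigenspace of a distance-regular graph depends only on the distance,
and its entries satisfy the three-term recurrence of the intersection array. -/
theorem exists_idem_eq (h : G.HasIntersectionArray D b c) (θ : ℝ) :
    ∃ e : ℕ → ℝ, (∀ x y, F.idem θ x y = e (G.dist x y)) ∧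
      ∀ i ≤ D, c i * e (i - 1) + ((b 0 : ℝ) - b i - c i) * e i + b i * e (i + 1) = θ * e i := by
  obtain ⟨p, hp⟩ := F.exists_aeval_eq_idem θ
  obtain ⟨e, he⟩ := h.exists_aeval_adjMatrix_eq p
  rw [hp] at he
  refine ⟨e, he, fun i hi => ?_⟩
  obtain ⟨x, y, hxy⟩ := h.exists_dist_pair hi
  have h1 := congrFun (congrFun (F.mul_idem θ) y) x
  rw [adjMatrix_mul_apply, Matrix.smul_apply, smul_eq_mul, he, dist_comm, hxy] at h1
  rw [← h.sum_adj hxy, ← h1, neighborFinset_eq_filter]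
  exact sum_congr rfl fun w _ => by rw [he, dist_comm]

theorem _root_.EigenFrame.idem_zero_pos {θ : ℝ} {e : ℕ → ℝ}
    (he : ∀ x y, F.idem θ x y = e (G.dist x y)) {i : V} (hi : F.val i = θ) : 0 < e 0 := by
  obtain ⟨x, hx⟩ := F.exists_vec_ne_zero i
  have := he x x
  rw [dist_self, F.idem_apply] at this
  rw [← this]
  refine sum_pos' (fun j _ => mul_self_nonneg _) ⟨i, by simp [hi], ?_⟩
  exact mul_self_pos.mpr hx

theorem idem_one (h : G.HasIntersectionArray D b c) {θ : ℝ} {e : ℕ → ℝ}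
    (hrec : ∀ i ≤ D, c i * e (i - 1) + ((b 0 : ℝ) - b i - c i) * e i + b i * e (i + 1) = θ * e i) :
    (b 0 : ℝ) * e 1 = θ * e 0 := by
  have := hrec 0 (Nat.zero_le _)
  rw [h.c_zero] at this
  simpa using this

/-- An eigenvector for the valency is constant. -/
theorem vec_eq_of_val_eq (h : G.HasIntersectionArray D b c) (hk : 0 < b 0) {i : V}
    (hi : F.val i = b 0) (x y : V) : F.vec i x = F.vec i y := by
  obtain ⟨e, he, hrec⟩ := h.exists_idem_eq F (b 0)
  have h1 := h.idem_one hrec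
  have hk' : (0 : ℝ) < b 0 := by exact_mod_cast hk
  have h2 : e 1 = e 0 := mul_left_cancel₀ hk'.ne' h1
  have adj : ∀ x y, G.Adj x y → F.vec i x = F.vec i y := by
    intro x y hxy
    have h3 := F.sum_sub_sq (b 0) x y
    simp only [he, dist_self, dist_eq_one_iff_adj.mpr hxy, h2] at h3
    have h4 := (sum_eq_zero_iff_of_nonneg (fun j _ => sq_nonneg (F.vec j x - F.vec j y))).mp
      (h3.trans (by ring)) i (by simp [hi])
    exact sub_eq_zero.mp (pow_eq_zero_iff (two_ne_zero) |>.mp h4)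
  obtain ⟨p⟩ := h.connected.preconnected x y
  induction p with
  | nil => rfl
  | cons hxy _ ih => exact (adj _ _ hxy).trans ih

theorem val_le (h : G.HasIntersectionArray D b c) (hD : 1 ≤ D) (i : V) :
    F.val i ≤ b 0 := by
  obtain ⟨e, he, hrec⟩ := h.exists_idem_eq F (F.val i)
  have h1 := h.idem_one hrec
  have h0 := F.idem_zero_pos he rfl
  obtain ⟨x, y, hxy⟩ := h.exists_dist_pair hD
  have h3 := F.sum_sub_sq (F.val i) x y
  simp only [he, dist_self, hxy] at h3
  have h4 : 0 ≤ ∑ j with F.val j = F.val i, (F.vec j x - F.vec j y) ^ 2 := by positivity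
  have h5 : e 1 ≤ e 0 := by linarith
  have hk : (0 : ℝ) ≤ b 0 := by positivity
  nlinarith

/-- A distance-regular graph with eigenvalue minus the valency is bipartite: an eigenvector changes
sign along every edge. -/
theorem isBipartite_of_val_eq_neg (h : G.HasIntersectionArray D b c) (hk : 0 < b 0) {i : V}
    (hi : F.val i = -(b 0 : ℝ)) : G.IsBipartite := by
  obtain ⟨e, he, hrec⟩ := h.exists_idem_eq F (-(b 0 : ℝ))
  have h1 := h.idem_one hrec
  have hk' : (0 : ℝ) < b 0 := by exact_mod_cast hk
  have h2 : e 1 = -e 0 := mul_left_cancel₀ hk'.ne' (by linarith)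
  have adj : ∀ x y, G.Adj x y → F.vec i x = -F.vec i y := by
    intro x y hxy
    have h3 := F.sum_add_sq (-(b 0 : ℝ)) x y
    simp only [he, dist_self, dist_eq_one_iff_adj.mpr hxy, h2] at h3
    have h4 := (sum_eq_zero_iff_of_nonneg (fun j _ => sq_nonneg (F.vec j x + F.vec j y))).mp
      (h3.trans (by ring)) i (by simp [hi])
    exact eq_neg_of_add_eq_zero_left (pow_eq_zero_iff (two_ne_zero) |>.mp h4)
  obtain ⟨z, hz⟩ := F.exists_vec_ne_zero i
  have hne : ∀ x, F.vec i x ≠ 0 := by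
    intro x
    obtain ⟨p⟩ := h.connected.preconnected z x
    induction p with
    | nil => exact hz
    | cons hxy _ ih => exact ih fun h0 => hz (by rw [adj _ _ hxy, h0, neg_zero])
  refine ⟨Coloring.mk (fun x => if 0 < F.vec i x then 0 else 1) ?_⟩
  intro x y hxy
  have h3 := adj x y hxy
  have h4 := hne y
  rcases lt_or_gt_of_ne h4 with h5 | h5
  · rw [if_pos (by linarith), if_neg (by linarith)]; decide
  · rw [if_neg (by linarith), if_pos (by linarith)]; decide

theorem exists_val_eq_valency (h : G.HasIntersectionArray D b c) :
    ∃ i, F.val i = b 0 := by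
  refine F.exists_val_eq (f := fun _ => 1) ?_ ?_ ?_
  · exact G.isHermitian_adjMatrix ℝ
  · ext x
    rw [adjMatrix_mulVec_apply, neighborFinset_eq_filter]
    simp [h.card_adj]
  · obtain ⟨x⟩ := h.connected.nonempty
    exact fun h0 => one_ne_zero (congrFun h0 x)

end HasIntersectionArray
end SimpleGraph

/-! ### Edges spanned by a set of neighbours -/

/-- The arithmetic behind `SimpleGraph.HasIntersectionArray.sq_card_mul_le`: `e₀`, `e₁`, `e₂` are
the first entries of the projection onto the eigenspace of `θ`. -/
theorem le_of_recurrence {k b₁ θ n s e₀ e₁ e₂ : ℝ} (hk : 0 < k) (hb1 : 0 < b₁) (hn0 : 0 ≤ n)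
    (hab : b₁ + 1 ≤ k) (h0 : 0 < e₀) (hi : θ < k) (hai : k - b₁ - 1 ≤ θ)
    (h1 : k * e₁ = θ * e₀) (h2 : e₀ + (k - b₁ - 1) * e₁ + b₁ * e₂ = θ * e₁)
    (hpsd : 0 ≤ (e₀ - e₂) * (n - n ^ 2 / k) + (e₁ - e₂) * (s - n ^ 2 * (k - b₁ - 1) / k)) :
    n ^ 2 * (k - b₁ - 1) / k ≤ s + n * (k / (k - b₁)) := by
  -- consequences of the recurrence: `b₁ (e₁ - e₂) = (θ + 1) (e₀ - e₁)`
  have h01 : k * (e₀ - e₁) = (k - θ) * e₀ := by linear_combination -h1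
  have hpos : 0 < e₀ - e₁ := by
    have : 0 < k * (e₀ - e₁) := by rw [h01]; exact mul_pos (by linarith) h0
    exact (mul_pos_iff_of_pos_left hk).mp this
  have h12 : b₁ * (e₁ - e₂) = (θ + 1) * (e₀ - e₁) := by linear_combination h1 - h2
  have hmain : 0 ≤ (e₀ - e₁) * ((b₁ + (θ + 1)) * (n - n ^ 2 / k) +
      (θ + 1) * (s - n ^ 2 * (k - b₁ - 1) / k)) := by
    have := mul_nonneg hb1.le hpsd
    have h3 : b₁ * ((e₀ - e₂) * (n - n ^ 2 / k) + (e₁ - e₂) *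
        (s - n ^ 2 * (k - b₁ - 1) / k)) = (e₀ - e₁) * ((b₁ + (θ + 1)) * (n - n ^ 2 / k) +
        (θ + 1) * (s - n ^ 2 * (k - b₁ - 1) / k)) := by
      linear_combination (s - n ^ 2 * (k - b₁ - 1) / k + (n - n ^ 2 / k)) * h12
    rwa [h3] at this
  have hmain2 := nonneg_of_mul_nonneg_right hmain hpos
  have hθ1 : 0 < θ + 1 := by linarith
  have hquot : n ^ 2 * (k - b₁ - 1) / k - s ≤ (b₁ + (θ + 1)) / (θ + 1) * n := by
    rw [div_mul_eq_mul_div, le_div_iff₀ hθ1]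
    have : 0 ≤ (b₁ + (θ + 1)) * (n ^ 2 / k) := by positivity
    linarith
  have hratio : (b₁ + (θ + 1)) / (θ + 1) ≤ k / (k - b₁) := by
    rw [div_le_div_iff₀ hθ1 (by linarith)]
    nlinarith
  have := mul_le_mul_of_nonneg_right hratio hn0
  linarith

namespace SimpleGraph
namespace HasIntersectionArray

variable {V : Type u} [Fintype V] [DecidableEq V] {G : SimpleGraph V} [DecidableRel G.Adj]
  {D : ℕ} {b c : ℕ → ℕ}

theorem card_common (h : G.HasIntersectionArray D b c) (hD : 1 ≤ D) {x y : V} (hxy : G.Adj x y) :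
    (#{z | G.Adj y z ∧ G.Adj x z} : ℝ) = (b 0 : ℝ) - b 1 - 1 := by
  have h1 := h.card_a (dist_eq_one_iff_adj.mpr hxy)
  rw [h.c_one hD] at h1
  simp only [dist_eq_one_iff_adj] at h1
  rw [← h1]; push_cast; ring

theorem sum_common (h : G.HasIntersectionArray D b c) (hD : 1 ≤ D) {x y : V} (hxy : G.Adj x y) :
    ∑ z, (if G.Adj x z then (1 : ℝ) else 0) * G.adjMatrix ℝ y z = (b 0 : ℝ) - b 1 - 1 := by
  rw [← h.card_common hD hxy, ← sum_boole]
  refine sum_congr rfl fun z _ => ?_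
  rw [adjMatrix_apply]
  split_ifs <;> simp_all

/-- In diameter at least four some non-trivial eigenvalue is at least `a 1 = b 0 - b 1 - 1`. The
difference `gp - gq` of the indicators of the neighbourhoods of two vertices at distance at least
four is orthogonal to the constants, and has Rayleigh quotient `a 1` because the two neighbourhoods
induce `a 1`-regular graphs with no edge between them. -/
theorem exists_val_ge (h : G.HasIntersectionArray D b c) (hD : 4 ≤ D)
    (F : EigenFrame (G.adjMatrix ℝ)) :
    ∃ i, F.val i < b 0 ∧ (b 0 : ℝ) - b 1 - 1 ≤ F.val i := by
  obtain ⟨p, q, hpq⟩ := h.exists_dist_pair hD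
  set gp : V → ℝ := fun z => if G.Adj p z then 1 else 0 with hgp
  set gq : V → ℝ := fun z => if G.Adj q z then 1 else 0 with hgq
  have hk := h.b_pos (show 0 < D by omega)
  -- neighbours of `p` and of `q` are at distance at least two
  have far : ∀ z w, G.Adj p z → G.Adj q w → z ≠ w ∧ ¬ G.Adj z w := by
    intro z w hz hw
    have h1 := h.dist_triangle p z q
    have h2 := h.dist_triangle z w q
    rw [dist_eq_one_iff_adj.mpr hz] at h1
    rw [dist_eq_one_iff_adj.mpr hw.symm] at h2
    refine ⟨?_, fun h3 => ?_⟩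
    · rintro rfl; rw [dist_self] at h2; omega
    · rw [dist_eq_one_iff_adj.mpr h3] at h2; omega
  set a : ℝ := (b 0 : ℝ) - b 1 - 1 with ha
  have hsum : ∀ v, ∑ z, (if G.Adj v z then (1 : ℝ) else 0) = b 0 := by
    intro v; rw [sum_boole, h.card_adj]
  have hrow : ∀ z, (gp z - gq z) * ∑ w, (gp w - gq w) * G.adjMatrix ℝ z w =
      a * (gp z - gq z) ^ 2 := by
    intro z
    simp only [sub_mul, sum_sub_distrib]
    by_cases hz : G.Adj p z
    · have h1 : gq z = 0 := if_neg fun hq => (far z z hz hq).1 rfl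
      have h2 : ∑ w, gq w * G.adjMatrix ℝ z w = 0 := by
        refine sum_eq_zero fun w _ => ?_
        by_cases hw : G.Adj q w
        · simp [(far z w hz hw).2]
        · simp [hgq, hw]
      rw [h2, h.sum_common (by omega) hz, h1, show gp z = 1 from if_pos hz, ha]; ring
    · have h1 : gp z = 0 := if_neg hz
      by_cases hz' : G.Adj q z
      · have h2 : ∑ w, gp w * G.adjMatrix ℝ z w = 0 := by
          refine sum_eq_zero fun w _ => ?_
          by_cases hw : G.Adj p w
          · have := (far w z hw hz').2
            simp [G.adj_comm z w, this]
          · simp [hgp, hw]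
        rw [h2, h.sum_common (by omega) hz', h1, show gq z = 1 from if_pos hz', ha]; ring
      · rw [h1, show gq z = 0 from if_neg hz']; ring
  have hquad := F.quadratic_eq (fun z => gp z - gq z)
  have hnorm := F.sum_sq_eq (fun z => gp z - gq z)
  have hL : ∑ x, ∑ y, (gp x - gq x) * (gp y - gq y) * G.adjMatrix ℝ x y =
      a * ∑ x, (gp x - gq x) ^ 2 := by
    rw [mul_sum]
    refine sum_congr rfl fun z _ => ?_
    rw [← hrow z, mul_sum]
    exact sum_congr rfl fun w _ => by ring
  rw [hL, hnorm, mul_sum] at hquad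
  by_contra! hne
  have horth : ∀ i, F.val i = b 0 → ∑ x, (gp x - gq x) * F.vec i x = 0 := by
    intro i hi
    rw [sum_congr rfl fun x _ => by rw [h.vec_eq_of_val_eq F hk hi x p], ← sum_mul,
      sum_sub_distrib, hsum, hsum]
    ring
  have hcoef : ∀ i, (F.val i - a) * (∑ x, (gp x - gq x) * F.vec i x) ^ 2 ≤ 0 := by
    intro i
    rcases (h.val_le F (by omega) i).lt_or_eq with hi | hi
    · exact mul_nonpos_of_nonpos_of_nonneg (by linarith [hne i hi]) (sq_nonneg _)
    · rw [horth i hi]; simp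
  have hzero : ∑ i, (F.val i - a) * (∑ x, (gp x - gq x) * F.vec i x) ^ 2 = 0 := by
    have h1 := sub_eq_zero.mpr hquad.symm
    rw [← sum_sub_distrib] at h1
    rw [← h1]
    exact sum_congr rfl fun i _ => sub_mul _ _ _
  have hall := (sum_eq_zero_iff_of_nonpos fun i _ => hcoef i).mp hzero
  have hsq : ∀ i, (∑ x, (gp x - gq x) * F.vec i x) ^ 2 = 0 := by
    intro i
    rcases (h.val_le F (by omega) i).lt_or_eq with hi | hi
    · have := hall i (mem_univ i)
      rcases mul_eq_zero.mp this with h0 | h0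
      · linarith [hne i hi]
      · exact h0
    · rw [horth i hi]; simp
  simp only [hsq, sum_const_zero] at hnorm
  obtain ⟨z, hz, -⟩ := h.exists_next (dist_self (G := G) (v := p)) (by omega)
  have h0 := (sum_eq_zero_iff_of_nonneg fun x _ => sq_nonneg (gp x - gq x)).mp hnorm z (mem_univ z)
  have h1 : gq z = 0 := if_neg fun hq => (far z z hz hq).1 rfl
  rw [h1, show gp z = 1 from if_pos hz] at h0
  norm_num at h0

/-- Let `θ` be a non-trivial eigenvalue with `θ ≥ a 1`. The projection onto its eigenspace is
positive semidefinite on the neighbourhood of `x`; tested on the indicator of `T`, made orthogonal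
to the constants, this says that `T` does not span much fewer edges than a random set of its
size. -/
theorem sq_card_mul_le (h : G.HasIntersectionArray D b c) (hD : 2 ≤ D)
    (F : EigenFrame (G.adjMatrix ℝ)) {i : V} (hi : F.val i < b 0)
    (hai : (b 0 : ℝ) - b 1 - 1 ≤ F.val i) (x : V) (T : Finset V) (hT : ∀ y ∈ T, G.Adj x y) :
    (#T : ℝ) ^ 2 * ((b 0 : ℝ) - b 1 - 1) / b 0 ≤
      ∑ p ∈ T, (#{q ∈ T | G.Adj p q} : ℝ) + #T * (b 0 / ((b 0 : ℝ) - b 1)) := by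
  obtain ⟨e, he, hrec⟩ := h.exists_idem_eq F (F.val i)
  set θ := F.val i with hθ
  have h0 := F.idem_zero_pos he hθ.symm
  have h1 := h.idem_one hrec
  have hk : (0 : ℝ) < b 0 := by exact_mod_cast h.b_pos (show 0 < D by omega)
  have hb1 : (0 : ℝ) < b 1 := by exact_mod_cast h.b_pos (show 1 < D by omega)
  have h2 := hrec 1 (by omega)
  rw [h.c_one (by omega)] at h2
  simp only [Nat.cast_one, one_mul, Nat.sub_self, Nat.reduceAdd] at h2
  have hab : (b 1 : ℝ) + 1 ≤ b 0 := by
    obtain ⟨x, y, hxy⟩ := h.exists_dist_pair (show 1 ≤ D by omega)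
    have := h.b_add_c_le hxy
    rw [h.c_one (by omega)] at this
    exact_mod_cast this
  set a : ℝ := (b 0 : ℝ) - b 1 - 1 with ha
  set n : ℝ := (#T : ℝ) with hn
  set t : V → ℝ := fun y => if y ∈ T then 1 else 0 with ht
  set g : V → ℝ := fun y => if G.Adj x y then 1 else 0 with hg
  have hgt : ∀ y, t y ≠ 0 → G.Adj x y := fun y hy => by
    by_contra hne; exact hy (if_neg fun hyT => hne (hT y hyT))
  have hST : ∑ y, t y = n := by simp [ht, hn]
  have hSg : ∑ y, g y = b 0 := by simp only [hg]; rw [sum_boole, h.card_adj]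
  have htg : ∑ y, ∑ z, t y * g z * G.adjMatrix ℝ y z = n * a := by
    rw [← hST, sum_mul]
    refine sum_congr rfl fun y _ => ?_
    simp only [mul_assoc, ← mul_sum]
    by_cases hy : t y = 0
    · simp [hy]
    · rw [h.sum_common (by omega) (hgt y hy)]
  have hgt' : ∑ y, ∑ z, g y * t z * G.adjMatrix ℝ y z = n * a := by
    rw [← htg, sum_comm]
    refine sum_congr rfl fun y _ => sum_congr rfl fun z _ => ?_
    simp only [adjMatrix_apply, G.adj_comm z y]; ring
  have hgg : ∑ y, ∑ z, g y * g z * G.adjMatrix ℝ y z = b 0 * a := by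
    rw [← hSg, sum_mul]
    refine sum_congr rfl fun y _ => ?_
    simp only [mul_assoc, ← mul_sum]
    by_cases hy : G.Adj x y
    · rw [h.sum_common (by omega) hy]
    · simp [hg, hy]
  have htt : ∑ y, ∑ z, t y * t z * G.adjMatrix ℝ y z = ∑ p ∈ T, (#{q ∈ T | G.Adj p q} : ℝ) := by
    rw [← sum_subset (subset_univ T)]
    · refine sum_congr rfl fun y hy => ?_
      rw [← sum_boole, ← sum_subset (subset_univ T)]
      · exact sum_congr rfl fun z hz => by simp [ht, hy, hz, adjMatrix_apply]
      · intro z _ hz; simp [ht, hz]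
    · intro y _ hy; simp [ht, hy]
  set eT := ∑ p ∈ T, (#{q ∈ T | G.Adj p q} : ℝ) with heT
  -- the quadratic form at `f = 1_T - (n / k) 1_{Γ(x)}`
  set f : V → ℝ := fun y => t y - n / b 0 * g y with hf
  have hfsupp : ∀ y, f y ≠ 0 → G.Adj x y := by
    intro y hy
    by_contra hne
    apply hy
    have : t y = 0 := by by_contra h3; exact hne (hgt y h3)
    simp [hf, this, hg, hne]
  have hSf : ∑ y, f y = 0 := by
    simp only [hf, sum_sub_distrib, ← mul_sum, hST, hSg]
    field_simp; ring
  have hSf2 : ∑ y, f y ^ 2 = n - n ^ 2 / b 0 := by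
    have : ∀ y, f y ^ 2 = t y - 2 * (n / b 0) * t y + (n / b 0) ^ 2 * g y := by
      intro y
      by_cases hy : y ∈ T
      · have := hT y hy
        simp only [hf, ht, hg, hy, this, if_true]; ring
      · simp only [hf, ht, hg, hy, if_false]; split_ifs <;> ring
    simp only [this, sum_add_distrib, sum_sub_distrib, ← mul_sum, hST, hSg]
    field_simp; ring
  have hSfA : ∑ y, ∑ z, f y * f z * G.adjMatrix ℝ y z = eT - n ^ 2 * a / b 0 := by
    have : ∀ y z, f y * f z * G.adjMatrix ℝ y z = t y * t z * G.adjMatrix ℝ y z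
        - n / b 0 * (t y * g z * G.adjMatrix ℝ y z) - n / b 0 * (g y * t z * G.adjMatrix ℝ y z)
        + (n / b 0) ^ 2 * (g y * g z * G.adjMatrix ℝ y z) := by
      intro y z; simp only [hf]; ring
    simp only [this, sum_add_distrib, sum_sub_distrib, ← mul_sum, htt, htg, hgt', hgg]
    field_simp; ring
  have hpsd := F.sum_mul_idem_nonneg θ f
  have hentry : ∀ y z, f y * f z * F.idem θ y z = e 2 * (f y * f z) +
      (e 0 - e 2) * (if y = z then f y * f z else 0) +
      (e 1 - e 2) * (f y * f z * G.adjMatrix ℝ y z) := by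
    intro y z
    by_cases hy : f y = 0
    · simp [hy]
    by_cases hz : f z = 0
    · simp [hz]
    have hxy := hfsupp y hy
    have hxz := hfsupp z hz
    rw [he]
    by_cases hyz : y = z
    · subst hyz; simp; ring
    · by_cases hadj : G.Adj y z
      · rw [dist_eq_one_iff_adj.mpr hadj]; simp [hadj, hyz]; ring
      · have h3 := h.connected.one_lt_dist_of_ne_of_not_adj hyz hadj
        have h4 := h.dist_adj_le y hxz
        rw [dist_eq_one_iff_adj.mpr hxy.symm] at h4
        rw [show G.dist y z = 2 by omega]
        simp [hadj, hyz]; ring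
  have hval : ∑ y, ∑ z, f y * f z * F.idem θ y z =
      (e 0 - e 2) * (n - n ^ 2 / b 0) + (e 1 - e 2) * (eT - n ^ 2 * a / b 0) := by
    simp only [hentry, sum_add_distrib, ← mul_sum, hSfA, ← hSf2]
    rw [← sum_mul, hSf]
    simp [sq]
  rw [hval] at hpsd
  exact le_of_recurrence hk hb1 (by positivity) hab h0 hi hai h1 h2 hpsd

end HasIntersectionArray
end SimpleGraph

/-! ### Edges spanned by sets of common neighbours -/

namespace SimpleGraph

variable {V : Type u} [Fintype V] [DecidableEq V] (G : SimpleGraph V) [DecidableRel G.Adj]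

/-- The set of common neighbours of `x` and `y`. -/
def commonNbrs (x y : V) : Finset V := {w | G.Adj x w ∧ G.Adj y w}

/-- The number of ordered pairs of adjacent vertices in `T`, that is, twice the number of edges
spanned by `T`. -/
def spanCount (T : Finset V) : ℕ := ∑ p ∈ T, #{q ∈ T | G.Adj p q}

variable {G}

theorem mem_commonNbrs {x y w : V} : w ∈ G.commonNbrs x y ↔ G.Adj x w ∧ G.Adj y w := by
  simp [commonNbrs]

theorem spanCount_eq_sum (T : Finset V) :
    G.spanCount T = ∑ p, ∑ q, if p ∈ T ∧ q ∈ T ∧ G.Adj p q then 1 else 0 := by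
  rw [spanCount, ← sum_subset (subset_univ T)]
  · refine sum_congr rfl fun p hp => ?_
    rw [card_filter, ← sum_subset (subset_univ T)]
    · exact sum_congr rfl fun q hq => by simp [hp, hq]
    · intro q _ hq; simp [hq]
  · intro p _ hp; simp [hp]

theorem spanCount_le (T : Finset V) : G.spanCount T ≤ #T * (#T - 1) := by
  rw [spanCount, ← smul_eq_mul]
  refine sum_le_card_nsmul _ _ _ fun p hp => ?_
  rw [← card_erase_of_mem hp]
  refine card_le_card fun q hq => ?_
  simp only [mem_filter] at hq
  exact mem_erase.mpr ⟨hq.2.ne', hq.1⟩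

theorem spanCount_union {S T : Finset V} (hST : ∀ p ∈ S, ∀ q ∈ T, p ≠ q ∧ ¬ G.Adj p q) :
    G.spanCount (S ∪ T) = G.spanCount S + G.spanCount T := by
  have hd : Disjoint S T := Finset.disjoint_left.mpr fun p hp hq => (hST p hp p hq).1 rfl
  rw [spanCount, sum_union hd, spanCount, spanCount]
  congr 1
  · refine sum_congr rfl fun p hp => ?_
    rw [filter_union, card_union_of_disjoint (disjoint_filter_filter hd), add_eq_left,
      card_eq_zero, filter_eq_empty_iff]
    exact fun q hq => (hST p hp q hq).2
  · refine sum_congr rfl fun p hp => ?_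
    rw [filter_union, card_union_of_disjoint (disjoint_filter_filter hd), add_eq_right,
      card_eq_zero, filter_eq_empty_iff]
    exact fun q hq hpq => (hST q hq p hp).2 hpq.symm

namespace HasIntersectionArray

variable {D : ℕ} {b c : ℕ → ℕ}

theorem card_commonNbrs_adj (h : G.HasIntersectionArray D b c) (hD : 1 ≤ D) {x y : V}
    (hxy : G.Adj x y) : (#(G.commonNbrs x y) : ℝ) = (b 0 : ℝ) - b 1 - 1 := by
  rw [← h.card_common hD hxy.symm, commonNbrs]

theorem card_commonNbrs_two (h : G.HasIntersectionArray D b c) {x y : V}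
    (hxy : G.dist x y = 2) : #(G.commonNbrs x y) = c 2 := by
  rw [← h.card_c hxy, commonNbrs]
  congr 1
  ext w
  simp only [mem_filter, mem_univ, true_and, Nat.reduceEqDiff, dist_eq_one_iff_adj]
  tauto

/-- Double counting of the edges spanned by the sets of common neighbours of `x` with the
vertices at distance two. -/
theorem sum_spanCount (h : G.HasIntersectionArray D b c) (hD : 1 ≤ D) (x : V) :
    ∑ y with G.dist x y = 2, (G.spanCount (G.commonNbrs x y) : ℝ) =
      ∑ p with G.Adj x p, (((b 0 : ℝ) - b 1 - 1) * ((b 0 : ℝ) - b 1 - 2) -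
        G.spanCount (G.commonNbrs x p)) := by
  set a : ℝ := (b 0 : ℝ) - b 1 - 1 with ha
  have key : ∀ p q, G.Adj x p → G.Adj x q → G.Adj p q →
      (#{y | G.dist x y = 2 ∧ G.Adj y p ∧ G.Adj y q} : ℝ) =
        a - 1 - #{y | G.Adj x y ∧ G.Adj p y ∧ G.Adj q y} := by
    intro p q hxp hxq hpq
    have h1 := h.card_commonNbrs_adj hD hpq
    have h2 : G.commonNbrs p q = insert x (({y | G.dist x y = 2 ∧ G.Adj y p ∧ G.Adj y q} :
        Finset V) ∪ ({y | G.Adj x y ∧ G.Adj p y ∧ G.Adj q y} : Finset V)) := by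
      ext y
      simp only [mem_commonNbrs, mem_insert, mem_union, mem_filter, mem_univ, true_and]
      constructor
      · rintro ⟨hp, hq⟩
        have h3 := h.dist_adj_le x hp
        rw [dist_eq_one_iff_adj.mpr hxp] at h3
        obtain h4 | h4 | h4 : G.dist x y = 0 ∨ G.dist x y = 1 ∨ G.dist x y = 2 := by omega
        · exact Or.inl (h.connected.dist_eq_zero_iff.mp h4).symm
        · exact Or.inr (Or.inr ⟨dist_eq_one_iff_adj.mp h4, hp, hq⟩)
        · exact Or.inr (Or.inl ⟨h4, hp.symm, hq.symm⟩)
      · rintro (rfl | ⟨-, hp, hq⟩ | ⟨-, hp, hq⟩)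
        · exact ⟨hxp.symm, hxq.symm⟩
        · exact ⟨hp.symm, hq.symm⟩
        · exact ⟨hp, hq⟩
    rw [h2, card_insert_of_notMem, card_union_of_disjoint] at h1
    · push_cast at h1; linarith
    · rw [Finset.disjoint_left]
      intro y hy hy'
      simp only [mem_filter, mem_univ, true_and] at hy hy'
      have := dist_eq_one_iff_adj.mpr hy'.1
      omega
    · simp
  have hL : ∑ y with G.dist x y = 2, (G.spanCount (G.commonNbrs x y) : ℝ) =
      ∑ p with G.Adj x p, ∑ q with G.Adj x q ∧ G.Adj p q,
        (#{y | G.dist x y = 2 ∧ G.Adj y p ∧ G.Adj y q} : ℝ) := by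
    have : ∑ y with G.dist x y = 2, G.spanCount (G.commonNbrs x y) =
      ∑ p with G.Adj x p, ∑ q with G.Adj x q ∧ G.Adj p q,
        #{y | G.dist x y = 2 ∧ G.Adj y p ∧ G.Adj y q} := by
      simp only [spanCount_eq_sum, mem_commonNbrs, sum_filter, card_filter]
      have e1 : ∀ y, (if G.dist x y = 2 then ∑ p, ∑ q, if (G.Adj x p ∧ G.Adj y p) ∧
          (G.Adj x q ∧ G.Adj y q) ∧ G.Adj p q then 1 else 0 else 0) = ∑ p, ∑ q,
          if G.Adj x p ∧ (G.Adj x q ∧ G.Adj p q) ∧ G.dist x y = 2 ∧ G.Adj y p ∧ G.Adj y q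
            then 1 else 0 := by
        intro y
        split_ifs with h2
        · refine sum_congr rfl fun p _ => sum_congr rfl fun q _ => if_congr ?_ rfl rfl
          tauto
        · simp only [h2, false_and, and_false, if_false, sum_const_zero]
      have e2 : ∀ p, (if G.Adj x p then ∑ q, if G.Adj x q ∧ G.Adj p q then
          ∑ y, if G.dist x y = 2 ∧ G.Adj y p ∧ G.Adj y q then 1 else 0 else 0 else 0) =
          ∑ q, ∑ y,
          if G.Adj x p ∧ (G.Adj x q ∧ G.Adj p q) ∧ G.dist x y = 2 ∧ G.Adj y p ∧ G.Adj y q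
            then 1 else 0 := by
        intro p
        split_ifs with h2
        · refine sum_congr rfl fun q _ => ?_
          split_ifs with h3
          · exact sum_congr rfl fun y _ => if_congr (by tauto) rfl rfl
          · simp [h3]
        · simp [h2]
      rw [sum_congr rfl fun y _ => e1 y, sum_congr rfl fun p _ => e2 p, sum_comm]
      exact sum_congr rfl fun p _ => sum_comm
    exact_mod_cast this
  rw [hL]
  refine sum_congr rfl fun p hp => ?_
  have hxp : G.Adj x p := by simpa using hp
  have hcard : (#{q | G.Adj x q ∧ G.Adj p q} : ℝ) = a := h.card_commonNbrs_adj hD hxp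
  have hsp : (G.spanCount (G.commonNbrs x p) : ℝ) =
      ∑ q with G.Adj x q ∧ G.Adj p q, (#{y | G.Adj x y ∧ G.Adj p y ∧ G.Adj q y} : ℝ) := by
    rw [spanCount]
    push_cast
    refine sum_congr rfl fun q _ => ?_
    congr 2
    ext y
    simp [mem_commonNbrs, and_assoc]
  rw [hsp, sum_congr rfl fun q hq => key p q hxp (mem_filter.mp hq).2.1 (mem_filter.mp hq).2.2,
    sum_sub_distrib, sum_const, nsmul_eq_mul, hcard]
  ring

/-- The inequality `sq_card_mul_le` for the two sets of common neighbours of `y` with two vertices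
at mutual distance four. No edge joins these two sets. -/
theorem sq_c_two_mul_le (h : G.HasIntersectionArray D b c) (hD : 4 ≤ D)
    (F : EigenFrame (G.adjMatrix ℝ)) {i : V} (hi : F.val i < b 0)
    (hai : (b 0 : ℝ) - b 1 - 1 ≤ F.val i) {x x' y : V} (hx : G.dist y x = 2)
    (hx' : G.dist y x' = 2) (hxx : G.dist x x' = 4) :
    (2 * c 2 : ℝ) ^ 2 * ((b 0 : ℝ) - b 1 - 1) / b 0 ≤
      G.spanCount (G.commonNbrs y x) + G.spanCount (G.commonNbrs y x') +
        2 * c 2 * (b 0 / ((b 0 : ℝ) - b 1)) := by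
  have far : ∀ p ∈ G.commonNbrs y x, ∀ q ∈ G.commonNbrs y x', p ≠ q ∧ ¬ G.Adj p q := by
    intro p hp q hq
    rw [mem_commonNbrs] at hp hq
    have h1 := h.dist_adj_le x hq.2.symm
    have h2 := dist_eq_one_iff_adj.mpr hp.2
    refine ⟨?_, fun hpq => ?_⟩
    · rintro rfl; omega
    · have h3 := h.dist_adj_le x hpq; omega
  have hd : Disjoint (G.commonNbrs y x) (G.commonNbrs y x') :=
    Finset.disjoint_left.mpr fun p hp hq => (far p hp p hq).1 rfl
  have key := h.sq_card_mul_le (by omega) F hi hai y (G.commonNbrs y x ∪ G.commonNbrs y x') (by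
    intro p hp
    rcases mem_union.mp hp with hp | hp <;> exact (mem_commonNbrs.mp hp).1)
  have hs := spanCount_union far
  rw [spanCount] at hs
  rw [← Nat.cast_sum, hs, card_union_of_disjoint hd, h.card_commonNbrs_two hx,
    h.card_commonNbrs_two hx'] at key
  push_cast at key
  rw [← two_mul] at key
  exact key

/-- Sum of `sq_c_two_mul_le` over all pairs of vertices at distance two from `y` and four from each
other; every vertex at distance two from `y` lies in equally many such pairs. -/
theorem card_mul_le_sum_spanCount (h : G.HasIntersectionArray D b c) (hD : 4 ≤ D)
    (F : EigenFrame (G.adjMatrix ℝ)) {i : V} (hi : F.val i < b 0)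
    (hai : (b 0 : ℝ) - b 1 - 1 ≤ F.val i) (y : V) :
    #{x | G.dist y x = 2} * (2 * (c 2 : ℝ) ^ 2 * ((b 0 : ℝ) - b 1 - 1) / b 0 -
        c 2 * (b 0 / ((b 0 : ℝ) - b 1))) ≤
      ∑ x with G.dist y x = 2, (G.spanCount (G.commonNbrs y x) : ℝ) := by
  set B : ℝ := 2 * (c 2 : ℝ) ^ 2 * ((b 0 : ℝ) - b 1 - 1) / b 0 -
    c 2 * (b 0 / ((b 0 : ℝ) - b 1)) with hB
  set f : V → ℝ := fun x => G.spanCount (G.commonNbrs y x) with hf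
  set S : Finset V := {x | G.dist y x = 2} with hS
  have hc2 : 0 < c 2 := h.c_pos (i := 1) (by omega)
  obtain ⟨x₀, hx₀⟩ := h.exists_dist y (i := 2) (by omega)
  set N := #{z | G.dist y z = 2 ∧ G.dist x₀ z = 4} with hN
  have hdeg : ∀ x ∈ S, #{z ∈ S | G.dist x z = 4} = N := by
    intro x hx
    have h1 := h.card_two_step_mul (x := x) (y := y) (i := 2)
      (by rw [dist_comm]; simpa [hS] using hx)
    have h2 := h.card_two_step_mul (x := x₀) (y := y) (i := 2) (by rw [dist_comm]; exact hx₀)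
    rw [hS, filter_filter]
    exact Nat.eq_of_mul_eq_mul_right hc2 (h1.trans h2.symm)
  have hNpos : 0 < N := by
    have h2 := h.card_two_step_mul (x := x₀) (y := y) (i := 2) (by rw [dist_comm]; exact hx₀)
    have h3 := h.b_pos (show 2 < D by omega)
    have h4 := h.b_pos (show 3 < D by omega)
    by_contra h0
    have h5 : N = 0 := by omega
    rw [← hN, h5, zero_mul] at h2
    exact absurd h2.symm (Nat.mul_pos h3 h4).ne'
  have hpair : ∀ x ∈ S, ∀ z ∈ S, G.dist x z = 4 → 2 * B ≤ f x + f z := by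
    intro x hx z hz hxz
    have := h.sq_c_two_mul_le hD F hi hai (by simpa [hS] using hx) (by simpa [hS] using hz) hxz
    have h2 : (2 * c 2 : ℝ) ^ 2 * ((b 0 : ℝ) - b 1 - 1) / b 0 =
      2 * (2 * (c 2 : ℝ) ^ 2 * ((b 0 : ℝ) - b 1 - 1) / b 0) := by ring
    rw [h2] at this
    simp only [hf, hB]
    linarith
  have hsum : ∑ x ∈ S, ∑ z ∈ S with G.dist x z = 4, 2 * B ≤
      ∑ x ∈ S, ∑ z ∈ S with G.dist x z = 4, (f x + f z) :=
    sum_le_sum fun x hx => sum_le_sum fun z hz =>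
      hpair x hx z (mem_filter.mp hz).1 (mem_filter.mp hz).2
  have hl : ∑ x ∈ S, ∑ z ∈ S with G.dist x z = 4, 2 * B = #S * (N * (2 * B)) := by
    rw [sum_congr rfl fun x hx => by rw [sum_const, hdeg x hx, nsmul_eq_mul]]
    rw [sum_const, nsmul_eq_mul]
  have hr1 : ∑ x ∈ S, ∑ z ∈ S with G.dist x z = 4, f x = N * ∑ x ∈ S, f x := by
    rw [sum_congr rfl fun x hx => by rw [sum_const, hdeg x hx, nsmul_eq_mul], mul_sum]
  have hr2 : ∑ x ∈ S, ∑ z ∈ S with G.dist x z = 4, f z = N * ∑ x ∈ S, f x := by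
    rw [← hr1]
    simp only [sum_filter]
    rw [sum_comm]
    simp only [dist_comm]
  simp only [sum_add_distrib] at hsum
  rw [hl, hr1, hr2] at hsum
  have hN' : (0 : ℝ) < N := by exact_mod_cast hNpos
  have : (N : ℝ) * (2 * (#S * B)) ≤ N * (2 * ∑ x ∈ S, f x) := by linarith
  have := le_of_mul_le_mul_left this hN'
  linarith

end HasIntersectionArray
end SimpleGraph

/-! ### Diameter at least four -/

/-- No real parameters satisfy the inequalities that hold for a distance-regular graph of diameter
at least four (see `SimpleGraph.HasIntersectionArray.diam_lt_four`); `s` stands for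
`k / (a + 1)`. -/
theorem false_of_four_le_diam_bounds {k a b₁ c₂ s ε : ℝ} (hk : k = 1 + a + b₁) (ha : 0 ≤ a)
    (hs : s * (a + 1) = k) (hc : 0 < c₂) (hck : 2 * c₂ ≤ k) (hcb : c₂ ≤ b₁) (hε : 0 < ε)
    (hb : b₁ ≤ (2 - ε) * c₂) (hbig : 800 ≤ k * ε ^ 4)
    (h1 : a * b₁ * (2 * c₂ - a) ≤ k * b₁ * s + k ^ 2)
    (h2 : 2 * c₂ * a ≤ k * (c₂ - 1) + k * s) : False := by
  have hε1 : ε ≤ 1 := by nlinarith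
  have hb1 : 0 < b₁ := by linarith
  have hk0 : 0 < k := by linarith
  have hkε2 : 800 ≤ k * ε ^ 2 :=
    hbig.trans (mul_le_mul_of_nonneg_left (pow_le_pow_of_le_one hε.le hε1 (by norm_num)) hk0.le)
  have hkε : 800 ≤ k * ε := by
    have := mul_le_mul_of_nonneg_left (pow_le_pow_of_le_one hε.le hε1 one_le_two) hk0.le
    rw [pow_one] at this
    exact hkε2.trans this
  have hk800 : 800 ≤ k := hkε.trans (mul_le_of_le_one_right hk0.le hε1)
  have ha1 : ε * k / 2 ≤ a + 1 := by
    have := mul_le_mul_of_nonneg_left hck (show 0 ≤ 2 - ε by linarith)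
    linarith
  have hs0 : 0 < s := by
    by_contra h; push Not at h
    have := mul_nonpos_of_nonpos_of_nonneg h (show 0 ≤ a + 1 by linarith)
    linarith
  have hs2 : ε * s ≤ 2 := by
    have := mul_le_mul_of_nonneg_left ha1 hs0.le
    rw [hs] at this
    have : (ε * s) * k ≤ 2 * k := by linarith
    exact le_of_mul_le_mul_right this hk0
  -- the valency is at least about twice `a`
  have h3 : (2 * a - k) * (a + 1) ≤ 2 * k := by
    have e1 : c₂ * (2 * a - k) ≤ k * (s - 1) := by linarith
    have e2 : c₂ * (2 * a - k) * (a + 1) ≤ k * (s - 1) * (a + 1) :=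
      mul_le_mul_of_nonneg_right e1 (by linarith)
    have e3 : k * (s - 1) * (a + 1) = k * b₁ := by
      linear_combination k * hs + k * hk
    have e4 : k * b₁ ≤ k * (2 * c₂) :=
      mul_le_mul_of_nonneg_left (by nlinarith) hk0.le
    have : c₂ * ((2 * a - k) * (a + 1)) ≤ c₂ * (2 * k) := by linarith
    exact le_of_mul_le_mul_left this hc
  have h4 : 2 * a ≤ k + 4 := by
    by_contra h; push Not at h
    have := mul_lt_mul'' (show 4 < 2 * a - k by linarith) (show k / 2 < a + 1 by linarith)
      (by norm_num) (by linarith)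
    linarith
  have hb49 : 0.49 * k ≤ b₁ := by linarith
  have h5 : a * (2 * c₂ - a) ≤ k * s + 2.1 * k := by
    have e1 : k * k ≤ k * (2.1 * b₁) := mul_le_mul_of_nonneg_left (by linarith) hk0.le
    have : b₁ * (a * (2 * c₂ - a)) ≤ b₁ * (k * s + 2.1 * k) := by linarith
    exact le_of_mul_le_mul_left this hb1
  have h6 : ε * (a * (2 * c₂ - a)) ≤ 4.1 * k := by
    have e1 := mul_le_mul_of_nonneg_left h5 hε.le
    have e2 := mul_le_mul_of_nonneg_right hs2 hk0.le
    have e3 := mul_le_mul_of_nonneg_right hε1 hk0.le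
    linarith
  have h7 : b₁ * (1 + ε / 2) ≤ 2 * c₂ := by
    have e1 := mul_le_mul_of_nonneg_right hb (show 0 ≤ 1 + ε / 2 by linarith)
    have e2 : 0 ≤ ε ^ 2 * c₂ := by positivity
    linarith
  have hεb := mul_le_mul_of_nonneg_left hb49 hε.le
  have h8 : ε * k ^ 2 / 20 ≤ a * (2 * c₂ - a) := by
    have hεk2 : 0 ≤ ε * k ^ 2 := by positivity
    rcases le_total a (k / 4) with h | h
    · have e1 : k / 4 ≤ 2 * c₂ - a := by linarith
      have e2 : ε * k / 4 ≤ a := by linarith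
      have := mul_le_mul e2 e1 (by linarith) ha
      linarith
    · have e1 : 0.2 * (ε * k) ≤ 2 * c₂ - a := by linarith
      have := mul_le_mul h e1 (by positivity) ha
      linarith
  have h9 := mul_le_mul_of_nonneg_left h8 hε.le
  have h10 := mul_le_mul_of_nonneg_left hkε2 hk0.le
  linarith

namespace SimpleGraph
namespace HasIntersectionArray

variable {V : Type u} [Fintype V] [DecidableEq V] {G : SimpleGraph V} [DecidableRel G.Adj]
  {D : ℕ} {b c : ℕ → ℕ}

/-- If the valency is large and `b 1 ≤ (2 - ε) c 2` then the diameter is at most three. Otherwise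
the number of edges spanned by the sets of common neighbours of `y` with the vertices at distance
two from `y` is bounded from below by `card_mul_le_sum_spanCount`, and from above by `sum_spanCount`
together with `sq_card_mul_le` for the common neighbours of the ends of an edge. This clashes with
the upper bound for `a 1` that comes from `spanCount_le`. -/
theorem diam_lt_four (h : G.HasIntersectionArray D b c) {ε : ℝ} (hε : 0 < ε)
    (hb : (b 1 : ℝ) ≤ (2 - ε) * c 2) (hbig : 800 ≤ b 0 * ε ^ 4) : D < 4 := by
  by_contra! hD
  obtain ⟨F⟩ := EigenFrame.nonempty_of_isHermitian (G.isHermitian_adjMatrix ℝ)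
  obtain ⟨i, hi, hai⟩ := h.exists_val_ge hD F
  obtain ⟨x, x', hxx⟩ := h.exists_dist_pair hD
  obtain ⟨y, hxy, hxy'⟩ := h.exists_between (i := 2) (j := 2) hxx
  rw [dist_comm] at hxy hxy'
  have hc2 : 0 < c 2 := h.c_pos (i := 1) (by omega)
  have hk : (0 : ℝ) < b 0 := by exact_mod_cast h.b_pos (show 0 < D by omega)
  have hab : (b 1 : ℝ) + 1 ≤ b 0 := by
    obtain ⟨x, y, hxy⟩ := h.exists_dist_pair (show 1 ≤ D by omega)
    have := h.b_add_c_le hxy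
    rw [h.c_one (by omega)] at this
    exact_mod_cast this
  set a : ℝ := (b 0 : ℝ) - b 1 - 1 with ha
  set s : ℝ := b 0 / ((b 0 : ℝ) - b 1) with hs
  have hsa : s * (a + 1) = b 0 := by
    rw [hs, ha, sub_add_cancel, div_mul_cancel₀]; linarith
  have hs0 : 0 ≤ s := div_nonneg hk.le (by linarith)
  have hcR : (0 : ℝ) < c 2 := by exact_mod_cast hc2
  refine false_of_four_le_diam_bounds (k := b 0) (a := a) (b₁ := b 1) (c₂ := c 2) (s := s)
    (by rw [ha]; ring) (by linarith) hsa hcR ?_ ?_ hε hb hbig ?_ ?_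
  · have h1 := h.c_le_b (i := 2) (j := 2) hD
    have h2 := h.b_add_c_le hxy
    have : 2 * c 2 ≤ b 0 := by omega
    exact_mod_cast this
  · exact_mod_cast h.c_le_b (i := 2) (j := 1) (by omega)
  · have h1 := h.card_mul_le_sum_spanCount hD F hi hai y
    rw [h.sum_spanCount (by omega)] at h1
    have h2 : ∀ p, G.Adj y p → a * (a - 1) - (G.spanCount (G.commonNbrs y p) : ℝ) ≤
        a * (a - 1) - a ^ 2 * a / b 0 + b 0 := by
      intro p hp
      have h3 := h.sq_card_mul_le (by omega) F hi hai y (G.commonNbrs y p)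
        fun q hq => (mem_commonNbrs.mp hq).1
      rw [← Nat.cast_sum, ← spanCount, h.card_commonNbrs_adj (by omega) hp] at h3
      have h4 : a * s ≤ b 0 := by rw [← hsa]; linarith
      linarith
    rw [show (b 0 : ℝ) - b 1 - 2 = a - 1 by rw [ha]; ring, ← ha, ← hs] at h1
    have h3 := h1.trans (sum_le_sum fun p hp => h2 p (mem_filter.mp hp).2)
    rw [sum_const, h.card_adj, nsmul_eq_mul] at h3
    have h4 := h.card_sphere_mul y 1
    rw [h.card_sphere_one] at h4
    have h5 : (#{x | G.dist y x = 2} : ℝ) * c 2 = b 0 * b 1 := by exact_mod_cast h4.symm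
    have h6 : (#{x | G.dist y x = 2} : ℝ) * (2 * (c 2 : ℝ) ^ 2 * a / b 0 - c 2 * s) =
        2 * b 1 * c 2 * a - b 0 * b 1 * s := by
      field_simp
      linear_combination (2 * (c 2 : ℝ) * a - b 0 * s) * h5
    have h7 : (b 0 : ℝ) * (a * (a - 1) - a ^ 2 * a / b 0 + b 0) =
        b 0 * a * (a - 1) - a ^ 3 + b 0 ^ 2 := by field_simp
    rw [h6, h7] at h3
    have h8 : (b 0 : ℝ) = 1 + a + b 1 := by rw [ha]; ring
    nlinarith
  · have h1 := h.sq_c_two_mul_le hD F hi hai hxy hxy' hxx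
    have h2 := spanCount_le (G := G) (G.commonNbrs y x)
    have h3 := spanCount_le (G := G) (G.commonNbrs y x')
    rw [h.card_commonNbrs_two hxy] at h2
    rw [h.card_commonNbrs_two hxy'] at h3
    have h4 : ((c 2 - 1 : ℕ) : ℝ) = c 2 - 1 := by push_cast [Nat.cast_sub hc2]; ring
    have h2' : (G.spanCount (G.commonNbrs y x) : ℝ) ≤ c 2 * (c 2 - 1) := by
      rw [← h4]; exact_mod_cast h2
    have h3' : (G.spanCount (G.commonNbrs y x') : ℝ) ≤ c 2 * (c 2 - 1) := by
      rw [← h4]; exact_mod_cast h3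
    have h5 : (2 * c 2 : ℝ) ^ 2 * a / b 0 ≤ 2 * (c 2 * (c 2 - 1)) + 2 * c 2 * s := by linarith
    rw [div_le_iff₀ hk] at h5
    have h6 : (2 * (c 2 : ℝ)) * (2 * c 2 * a) ≤ (2 * c 2) * (b 0 * (c 2 - 1) + b 0 * s) := by
      linarith
    exact le_of_mul_le_mul_left h6 (by linarith)

end HasIntersectionArray
end SimpleGraph

/-! ### Multiplicities of eigenvalues, and diameter three -/

namespace SimpleGraph
namespace HasIntersectionArray

variable {V : Type u} [Fintype V] [DecidableEq V] {G : SimpleGraph V} [DecidableRel G.Adj]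
  {D : ℕ} {b c : ℕ → ℕ} (F : EigenFrame (G.adjMatrix ℝ))

/-- Bound of the valency by the square of a multiplicity. The rows `u y` of the projection at the
neighbours `y` of `x` have only two mutual inner products `e 1`, `e 2`, and inner product `e 1` with
`u x`. Hence the tensors `(u y - u x) ⊗ (u y - (e 2 / e 1) u x)` form, up to a factor, a dual system
to the tensors `u z ⊗ u z`, and both are linearly independent. -/
theorem valency_le_multiplicity_sq (h : G.HasIntersectionArray D b c) {θ : ℝ} {e : ℕ → ℝ}
    (he : ∀ x y, F.idem θ x y = e (G.dist x y)) (h1 : e 1 ≠ 0) (h01 : e 0 ≠ e 1)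
    (h02 : e 0 ≠ e 2) : b 0 ≤ #{i | F.val i = θ} ^ 2 := by
  obtain ⟨x⟩ := h.connected.nonempty
  set r := e 2 / e 1 with hr
  set d := (e 0 - e 1) * (e 0 - e 2) with hd
  have hd0 : d ≠ 0 := mul_ne_zero (sub_ne_zero.mpr h01) (sub_ne_zero.mpr h02)
  let I := {i // F.val i = θ}
  let N := {y // G.Adj x y}
  have hip : ∀ z y : V, ∑ i : I, F.vec i z * F.vec i y = e (G.dist z y) := by
    intro z y
    rw [← he, F.idem_apply]
    exact sum_subtype_eq_sum_filter (s := univ) (p := fun i => F.val i = θ)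
      (f := fun i => F.vec i z * F.vec i y) |>.symm ▸ (by simp [I])
  let P : Matrix N (I × I) ℝ := Matrix.of fun z ij => d⁻¹ * (F.vec ij.1 z * F.vec ij.2 z)
  let Q : Matrix (I × I) N ℝ := Matrix.of fun ij y =>
    (F.vec ij.1 y - F.vec ij.1 x) * (F.vec ij.2 y - r * F.vec ij.2 x)
  have hPQ : P * Q = 1 := by
    ext z y
    have hz : G.dist z.1 x = 1 := dist_eq_one_iff_adj.mpr z.2.symm
    have e1 : (P * Q) z y = d⁻¹ * ((∑ i : I, F.vec i z * (F.vec i y - F.vec i x)) *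
        ∑ j : I, F.vec j z * (F.vec j y - r * F.vec j x)) := by
      rw [Matrix.mul_apply, Fintype.sum_prod_type, sum_mul_sum, mul_sum]
      refine sum_congr rfl fun i _ => ?_
      rw [mul_sum]
      refine sum_congr rfl fun j _ => ?_
      simp only [P, Q, Matrix.of_apply]
      ring
    have e2 : ∑ i : I, F.vec i z * (F.vec i y - F.vec i x) = e (G.dist z.1 y) - e 1 := by
      simp only [mul_sub, sum_sub_distrib, hip, hz]
    have e3 : ∑ i : I, F.vec i z * (F.vec i y - r * F.vec i x) = e (G.dist z.1 y) - e 2 := by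
      simp only [mul_sub, sum_sub_distrib, mul_left_comm _ r, ← mul_sum, hip, hz]
      rw [hr, div_mul_cancel₀ _ h1]
    rw [e1, e2, e3]
    by_cases hzy : z = y
    · subst hzy
      rw [dist_self, Matrix.one_apply_eq, ← hd, inv_mul_cancel₀ hd0]
    · rw [Matrix.one_apply_ne hzy]
      by_cases hadj : G.Adj z.1 y
      · rw [dist_eq_one_iff_adj.mpr hadj]; ring
      · have h3 := h.connected.one_lt_dist_of_ne_of_not_adj (fun h4 => hzy (Subtype.ext h4)) hadj
        have h4 := h.dist_adj_le z.1 y.2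
        rw [hz] at h4
        rw [show G.dist z.1 y = 2 by omega]; ring
  have hrank : Fintype.card N ≤ Fintype.card (I × I) := by
    calc Fintype.card N = (1 : Matrix N N ℝ).rank := Matrix.rank_one.symm
      _ = (P * Q).rank := by rw [hPQ]
      _ ≤ P.rank := Matrix.rank_mul_le_left P Q
      _ ≤ Fintype.card (I × I) := Matrix.rank_le_card_width P
  rw [Fintype.card_prod, Fintype.card_subtype, Fintype.card_subtype, h.card_adj, ← sq] at hrank
  exact hrank

/-- In a non-bipartite graph of diameter at least three, an eigenspace for a non-trivial eigenvalue
separates vertices at distance two. -/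
theorem idem_two_ne (h : G.HasIntersectionArray D b c) (hD : 3 ≤ D) (hnb : ¬ G.IsBipartite)
    {i : V} (hi : F.val i ≠ b 0) {e : ℕ → ℝ} (he : ∀ x y, F.idem (F.val i) x y = e (G.dist x y))
    (hrec : ∀ j ≤ D, c j * e (j - 1) + ((b 0 : ℝ) - b j - c j) * e j + b j * e (j + 1) =
      F.val i * e j) (h01 : e 0 ≠ e 1) : e 0 ≠ e 2 := by
  intro h02
  have h0 := F.idem_zero_pos he rfl
  have h1 := h.idem_one hrec
  have hkN := h.b_pos (show 0 < D by omega)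
  have hk : (0 : ℝ) < b 0 := by exact_mod_cast hkN
  have hvec : ∀ x y, G.dist x y = 2 → ∀ z, F.idem (F.val i) x z = F.idem (F.val i) y z := by
    intro x y hxy z
    have h3 := F.sum_sub_sq (F.val i) x y
    simp only [he, dist_self, hxy, ← h02] at h3
    rw [F.idem_apply, F.idem_apply]
    refine sum_congr rfl fun j hj => ?_
    have h4 := (sum_eq_zero_iff_of_nonneg (fun j _ => sq_nonneg (F.vec j x - F.vec j y))).mp
      (h3.trans (by ring)) j hj
    rw [sub_eq_zero.mp (pow_eq_zero_iff (two_ne_zero) |>.mp h4)]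
  -- so no vertex is at distance two from both ends of an edge
  have hno : ∀ x w y, G.dist x w = 2 → G.Adj w y → G.dist x y ≠ 2 := by
    intro x w y hxw hwy hxy
    have h3 := hvec x w hxw y
    rw [hvec x y hxy y, he, he, dist_self, dist_eq_one_iff_adj.mpr hwy] at h3
    exact h01 h3
  obtain ⟨x₀, x₃, h03⟩ := h.exists_dist_pair hD
  obtain ⟨x₁, hx01, hx31⟩ := h.exists_between (i := 1) (j := 2) h03
  obtain ⟨x₂, hx32, hx12⟩ := h.exists_between (i := 1) (j := 1) hx31
  by_cases ha : #{z | G.Adj x₂ z ∧ G.dist x₁ z = 1} = 0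
  · have h3 := h.card_a hx12
    rw [ha, h.c_one (by omega), zero_add] at h3
    have h4 : (b 0 : ℝ) = b 1 + 1 := by exact_mod_cast h3.symm
    have h5 := hrec 1 (by omega)
    rw [h.c_one (by omega)] at h5
    simp only [Nat.cast_one, one_mul, Nat.sub_self, Nat.reduceAdd, ← h02] at h5
    have h6 : (F.val i - b 0) * (F.val i + b 0) * e 0 = 0 := by
      linear_combination (-(b 0 : ℝ)) * h5 + ((b 0 : ℝ) - b 1 - 1 - F.val i) * h1
        - ((b 0 : ℝ) * e 0 - F.val i * e 0) * h4
    rcases mul_eq_zero.mp h6 with h7 | h7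
    · rcases mul_eq_zero.mp h7 with h8 | h8
      · exact hi (sub_eq_zero.mp h8)
      · exact hnb (h.isBipartite_of_val_eq_neg F hkN (eq_neg_of_add_eq_zero_left h8))
    · exact h0.ne' h7
  · obtain ⟨z, hz⟩ := card_pos.mp (Nat.pos_of_ne_zero ha)
    simp only [mem_filter, mem_univ, true_and, dist_eq_one_iff_adj] at hz
    have h4 := h.dist_adj_le x₃ hz.1
    have h5 := hno x₃ x₁ z hx31 hz.2
    have h6 := h.dist_adj_le x₃ hz.2
    have h7 := h.dist_triangle x₀ z x₃
    have h8 := h.dist_adj_le x₀ hz.2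
    have h9 : G.dist x₀ x₂ = 2 := by
      have h10 := h.dist_triangle x₀ x₁ x₂
      have h11 := h.dist_triangle x₀ x₂ x₃
      rw [G.dist_comm (u := x₂)] at h11
      omega
    have h10 := hno x₀ x₂ z h9 hz.1
    rw [G.dist_comm (u := z)] at h7
    omega

theorem adjMatrix_pow_apply_of_lt {n : ℕ} {x y : V} (hn : n < G.dist x y) :
    (G.adjMatrix ℝ ^ n) x y = 0 := by
  rw [adjMatrix_pow_apply_eq_card_walk, Nat.cast_eq_zero, Fintype.card_eq_zero_iff]
  exact ⟨fun p => by
    have h1 := SimpleGraph.dist_le p.1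
    have h2 : p.1.length = n := p.2
    omega⟩

/-- A distance-regular graph of diameter `D` has more than `D` distinct eigenvalues. Otherwise a
monic polynomial of degree `n ≤ D` annihilates the adjacency matrix; but at two vertices at distance
`n` its leading term does not vanish, and all other terms do. -/
theorem lt_card_image_val (h : G.HasIntersectionArray D b c) : D < #(univ.image F.val) := by
  by_contra! hle
  set p : Polynomial ℝ := ∏ t ∈ univ.image F.val, (Polynomial.X - Polynomial.C t) with hp
  have hdeg : p.natDegree = #(univ.image F.val) :=
    Polynomial.natDegree_finsetProd_X_sub_C_eq_card _ fun t => t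
  have hmon : p.Monic := Polynomial.monic_prod_X_sub_C _ _
  obtain ⟨x, y, hxy⟩ := h.exists_dist_pair hle
  have h0 : Polynomial.aeval (G.adjMatrix ℝ) p x y = 0 := by
    rw [F.aeval_apply]
    refine sum_eq_zero fun i _ => ?_
    rw [hp, Polynomial.eval_prod, prod_eq_zero (i := F.val i) (by simp) (by simp), zero_mul]
  rw [Polynomial.aeval_eq_sum_range, Matrix.sum_apply, sum_range_succ, sum_eq_zero] at h0
  · rw [hmon.coeff_natDegree, one_smul, zero_add, adjMatrix_pow_apply_eq_card_walk,
      Nat.cast_eq_zero, Fintype.card_eq_zero_iff] at h0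
    obtain ⟨w, hw⟩ := h.connected.exists_walk_length_eq_dist x y
    exact h0.false ⟨w, by simp [hw, hxy, hdeg]⟩
  · intro n hn
    rw [Matrix.smul_apply, adjMatrix_pow_apply_of_lt, smul_zero]
    rw [hxy, ← hdeg]
    exact mem_range.mp hn

/-- The trace of the square of the adjacency matrix. -/
theorem sum_val_sq (h : G.HasIntersectionArray D b c) :
    ∑ i, F.val i ^ 2 = Fintype.card V * b 0 := by
  have h1 : ∀ x, (b 0 : ℝ) = ∑ i, F.val i ^ 2 * (F.vec i x * F.vec i x) := by
    intro x
    have := F.aeval_apply (Polynomial.X ^ 2) x x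
    simp only [Polynomial.eval_pow, Polynomial.eval_X] at this
    rw [← this, map_pow, Polynomial.aeval_X, sq, adjMatrix_mul_apply, neighborFinset_eq_filter,
      ← h.card_adj x, card_filter, sum_filter]
    push_cast
    refine sum_congr rfl fun y _ => ?_
    split_ifs with hxy
    · simp [hxy.symm]
    · simp
  have h2 : ∑ _x : V, (b 0 : ℝ) = ∑ i, F.val i ^ 2 := by
    rw [sum_congr rfl fun x _ => h1 x, sum_comm]
    exact sum_congr rfl fun i _ => by rw [← mul_sum, F.orthonormal, if_pos rfl, mul_one]
  rw [← h2]
  simp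

/-- The characteristic polynomial of the intersection matrix in diameter three, divided by the
factor belonging to the valency. -/
theorem cubic_eq_zero (h : G.HasIntersectionArray 3 b c) {i : V} (hi : F.val i ≠ b 0) :
    F.val i ^ 3 + (c 3 - ((b 0 : ℝ) - b 1 - 1) - ((b 0 : ℝ) - b 2 - c 2)) * F.val i ^ 2 +
      ((c 2 * c 3 : ℝ) - c 3 * ((b 0 : ℝ) - b 1 - 1) - b 0 +
        ((b 0 : ℝ) - b 1 - 1) * ((b 0 : ℝ) - b 2 - c 2) - b 1 * c 2) * F.val i +
      ((c 2 * c 3 : ℝ) - c 3 * b 0 + ((b 0 : ℝ) - b 2 - c 2) * b 0) = 0 := by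
  obtain ⟨e, he, hrec⟩ := h.exists_idem_eq F (F.val i)
  have h0 := F.idem_zero_pos he rfl
  have e1 := h.idem_one hrec
  have e2 := hrec 1 (by norm_num)
  have e3 := hrec 2 (by norm_num)
  have e4 := hrec 3 le_rfl
  rw [h.c_one (by norm_num)] at e2
  rw [h.b_last] at e4
  simp only [Nat.cast_one, one_mul, Nat.sub_self, Nat.reduceAdd, Nat.reduceSub, Nat.cast_zero,
    zero_mul, add_zero, sub_zero] at e2 e3 e4
  set θ := F.val i
  set k : ℝ := (b 0 : ℝ)
  set a₁ : ℝ := k - b 1 - 1 with ha1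
  set a₂ : ℝ := k - b 2 - c 2 with ha2
  have s2 : k * b 1 * e 2 = (θ * (θ - a₁) - k) * e 0 := by
    linear_combination k * e2 + (θ - a₁) * e1
  have s3 : k * b 1 * b 2 * e 3 =
      ((θ - a₂) * (θ * (θ - a₁) - k) - c 2 * b 1 * θ) * e 0 := by
    linear_combination k * b 1 * e3 + (θ - a₂) * s2 - c 2 * b 1 * e1
  have s4 : (θ - (k - c 3)) * (((θ - a₂) * (θ * (θ - a₁) - k) - c 2 * b 1 * θ) * e 0) =
      c 3 * b 2 * ((θ * (θ - a₁) - k) * e 0) := by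
    linear_combination (-k * b 1 * b 2) * e4 - (θ - (k - c 3)) * s3 + c 3 * b 2 * s2
  have key : (θ - k) * e 0 * (θ ^ 3 + (c 3 - a₁ - a₂) * θ ^ 2 + (c 2 * c 3 - c 3 * a₁ - k +
      a₁ * a₂ - b 1 * c 2) * θ + (c 2 * c 3 - c 3 * k + a₂ * k)) = 0 := by
    simp only [ha1, ha2] at s4 ⊢
    linear_combination s4
  exact (mul_eq_zero.mp key).resolve_left (mul_ne_zero (sub_ne_zero.mpr hi) h0.ne')

/-- If the non-trivial eigenvalues of a non-bipartite graph of diameter three have multiplicity at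
least `N` (which holds when `N ^ 2` is at most the valency), then the trace of the square of the
adjacency matrix bounds the sum of the squares of the three non-trivial eigenvalues. That sum is
written here in terms of the intersection numbers, with `a i = b 0 - b i - c i`. -/
theorem mul_sum_sq_le (h : G.HasIntersectionArray 3 b c) (hnb : ¬ G.IsBipartite) {N : ℝ}
    (hN : N ^ 2 ≤ b 0) :
    N * (((b 0 : ℝ) - b 1 - 1 - c 2) ^ 2 + ((b 0 : ℝ) - c 3 - b 2) ^ 2 + 2 * (b 2 * c 2) +
      2 * ((b 0 : ℝ) - c 2)) ≤ b 0 * (Fintype.card V - b 0) := by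
  obtain ⟨F⟩ := EigenFrame.nonempty_of_isHermitian (G.isHermitian_adjMatrix ℝ)
  have hkN := h.b_pos (show 0 < 3 by norm_num)
  have hk : (0 : ℝ) < b 0 := by exact_mod_cast hkN
  have hmult : ∀ i, F.val i ≠ b 0 →
      N * F.val i ^ 2 ≤ #{j | F.val j = F.val i} * F.val i ^ 2 := by
    intro i hi
    by_cases h0 : F.val i = 0
    · simp [h0]
    refine mul_le_mul_of_nonneg_right ?_ (sq_nonneg _)
    obtain ⟨e, he, hrec⟩ := h.exists_idem_eq F (F.val i)
    have hpos := F.idem_zero_pos he rfl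
    have e1 := h.idem_one hrec
    have h01 : e 0 ≠ e 1 := by
      intro h01
      rw [← h01] at e1
      exact hi (mul_right_cancel₀ hpos.ne' e1).symm
    have h1 : e 1 ≠ 0 := by
      intro h1
      rw [h1, mul_zero] at e1
      exact mul_ne_zero h0 hpos.ne' e1.symm
    have hle := h.valency_le_multiplicity_sq F he h1 h01
      (h.idem_two_ne F le_rfl hnb hi he hrec h01)
    have hle' : (b 0 : ℝ) ≤ (#{j | F.val j = F.val i} : ℝ) ^ 2 := by exact_mod_cast hle
    exact le_of_sq_le_sq (hN.trans hle') (by positivity)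
  obtain ⟨i₀, hi₀⟩ := h.exists_val_eq_valency F
  have hcard : 3 ≤ #((univ.image F.val).erase (b 0 : ℝ)) := by
    have := h.lt_card_image_val F
    rw [card_erase_of_mem (mem_image.mpr ⟨i₀, mem_univ _, hi₀⟩)]
    omega
  obtain ⟨T, hT, hT3⟩ := exists_subset_card_eq hcard
  obtain ⟨p, q, r, hpq, hpr, hqr, rfl⟩ := card_eq_three.mp hT3
  have hroot : ∀ t ∈ ({p, q, r} : Finset ℝ), ∃ i, F.val i = t ∧ t ≠ b 0 := by
    intro t ht
    have := hT ht
    rw [mem_erase, mem_image] at this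
    obtain ⟨hne, i, -, hi⟩ := this
    exact ⟨i, hi, hne⟩
  obtain ⟨ip, hip, hpk⟩ := hroot p (by simp)
  obtain ⟨iq, hiq, hqk⟩ := hroot q (by simp)
  obtain ⟨ir, hir, hrk⟩ := hroot r (by simp)
  have cp := h.cubic_eq_zero F (i := ip) (hip ▸ hpk)
  have cq := h.cubic_eq_zero F (i := iq) (hiq ▸ hqk)
  have cr := h.cubic_eq_zero F (i := ir) (hir ▸ hrk)
  rw [hip] at cp; rw [hiq] at cq; rw [hir] at cr
  have mp := hmult ip (hip ▸ hpk)
  have mq := hmult iq (hiq ▸ hqk)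
  have mr := hmult ir (hir ▸ hrk)
  rw [hip] at mp; rw [hiq] at mq; rw [hir] at mr
  -- the elementary symmetric functions of the three roots
  set α : ℝ := c 3 - ((b 0 : ℝ) - b 1 - 1) - ((b 0 : ℝ) - b 2 - c 2) with hα
  set β : ℝ := (c 2 * c 3 : ℝ) - c 3 * ((b 0 : ℝ) - b 1 - 1) - b 0 +
        ((b 0 : ℝ) - b 1 - 1) * ((b 0 : ℝ) - b 2 - c 2) - b 1 * c 2 with hβ
  have d1 : p ^ 2 + p * q + q ^ 2 + α * (p + q) + β = 0 := by
    refine mul_left_cancel₀ (sub_ne_zero.mpr hpq) ?_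
    linear_combination cp - cq
  have d2 : p ^ 2 + p * r + r ^ 2 + α * (p + r) + β = 0 := by
    refine mul_left_cancel₀ (sub_ne_zero.mpr hpr) ?_
    linear_combination cp - cr
  have d3 : p + q + r + α = 0 := by
    refine mul_left_cancel₀ (sub_ne_zero.mpr hqr) ?_
    linear_combination d1 - d2
  have hsumsq : p ^ 2 + q ^ 2 + r ^ 2 = ((b 0 : ℝ) - b 1 - 1 - c 2) ^ 2 +
      ((b 0 : ℝ) - c 3 - b 2) ^ 2 + 2 * (b 2 * c 2) + 2 * ((b 0 : ℝ) - c 2) := by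
    have : p ^ 2 + q ^ 2 + r ^ 2 = α ^ 2 - 2 * β := by
      linear_combination (p + q + r - α - 2 * (p + q)) * d3 + 2 * d1
    rw [this, hα, hβ]; ring
  rw [← hsumsq]
  have hfib : ∑ i, F.val i ^ 2 =
      ∑ t ∈ univ.image F.val, (#{i | F.val i = t} : ℝ) * t ^ 2 := by
    rw [sum_comp (fun t : ℝ => t ^ 2) F.val]
    simp
  rw [h.sum_val_sq F, ← add_sum_erase _ _ (mem_image.mpr ⟨i₀, mem_univ _, hi₀⟩)] at hfib
  have hge := sum_le_sum_of_subset_of_nonneg (f := fun t : ℝ => (#{i | F.val i = t} : ℝ) * t ^ 2)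
    hT (fun t _ _ => by positivity)
  rw [sum_insert (by simp [hpq, hpr]), sum_insert (by simp [hqr]), sum_singleton] at hge
  have hone : (1 : ℝ) ≤ (#{i | F.val i = b 0} : ℝ) := by
    exact_mod_cast card_pos.mpr ⟨i₀, by simp [hi₀]⟩
  have := mul_le_mul_of_nonneg_right hone (sq_nonneg (b 0 : ℝ))
  linarith

end HasIntersectionArray
end SimpleGraph

/-! ### Counting in diameter three -/

namespace SimpleGraph
namespace HasIntersectionArray

variable {V : Type u} [Fintype V] [DecidableEq V] {G : SimpleGraph V} [DecidableRel G.Adj]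
  {D : ℕ} {b c : ℕ → ℕ}

/-- For `y` on a geodesic from `x` to `z`, next to `x`, the neighbours of `z` farther from `x` are
farther from `y`. -/
theorem b_succ_le_b (h : G.HasIntersectionArray D b c) {i : ℕ} (hi : i + 1 ≤ D) :
    b (i + 1) ≤ b i := by
  obtain ⟨x, z, hxz⟩ := h.exists_dist_pair hi
  obtain ⟨y, hxy, hzy⟩ := h.exists_between (i := 1) (j := i) (x := x) (z := z) (by omega)
  rw [G.dist_comm] at hzy
  rw [← h.card_b hxz, ← h.card_b hzy]
  apply card_le_card
  intro w
  simp only [mem_filter, mem_univ, true_and]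
  rintro ⟨hzw, hxw⟩
  have h1 := h.dist_triangle x y w
  have h2 := (h.dist_adj_le y hzw).1
  exact ⟨hzw, by omega⟩

theorem card_eq_add_card_sphere (h : G.HasIntersectionArray 3 b c) (x : V) :
    Fintype.card V = 1 + b 0 + #{y | G.dist x y = 2} + #{y | G.dist x y = 3} := by
  have h1 := card_eq_sum_card_fiberwise (s := (univ : Finset V)) (t := range 4) (f := G.dist x)
    fun y _ => by have := h.dist_le x y; simp; omega
  rw [sum_range_succ, sum_range_succ, sum_range_succ, sum_range_one, h.card_sphere_zero,
    h.card_sphere_one] at h1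
  exact h1

/-- In diameter three, for `z` at distance three from `x`: counting the paths of length two from
`z` to another vertex at distance three from `x` whose middle vertex is at distance two from `x`. -/
theorem c_three_mul_le (h : G.HasIntersectionArray 3 b c) {x z : V} (hxz : G.dist x z = 3) :
    (c 3 : ℝ) * (b 2 - 1) ≤ ((b 0 : ℝ) - c 3) * ((b 0 : ℝ) - b 1 - 1) +
      ((#{y | G.dist x y = 3} : ℝ) - 1 - ((b 0 : ℝ) - c 3)) * c 2 := by
  set S : Finset V := ({y | G.dist x y = 3} : Finset V).erase z with hS
  set U : Finset V := {u | G.Adj z u ∧ G.dist x u + 1 = 3} with hU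
  have hcount := sum_card_bipartiteAbove_eq_sum_card_bipartiteBelow (s := U) (t := S)
    (fun u y => G.Adj u y)
  have hleft : ∀ u ∈ U, #(bipartiteAbove (fun u y => G.Adj u y) S u) = b 2 - 1 := by
    intro u hu
    simp only [hU, mem_filter, mem_univ, true_and] at hu
    rw [← h.card_b (show G.dist x u = 2 by omega), ← card_erase_of_mem (a := z)]
    · congr 1
      ext w
      simp only [hS, mem_bipartiteAbove, mem_erase, mem_filter, mem_univ, true_and]
      tauto
    · simpa [hxz] using hu.1.symm
  rw [sum_const_nat hleft, h.card_c hxz] at hcount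
  have hadj : (#{y ∈ S | G.Adj z y} : ℝ) = (b 0 : ℝ) - c 3 := by
    have h1 := h.card_a hxz
    rw [h.b_last] at h1
    rw [← h1]
    have : #{y ∈ S | G.Adj z y} = #{w | G.Adj z w ∧ G.dist x w = 3} := by
      congr 1
      ext w
      simp only [hS, mem_erase, mem_filter, mem_univ, true_and]
      exact ⟨fun hw => ⟨hw.2, hw.1.2⟩, fun hw => ⟨⟨hw.1.ne', hw.2⟩, hw.1⟩⟩
    rw [this]
    push_cast
    ring
  have hright : ∀ y ∈ S, (#(bipartiteBelow (fun u y => G.Adj u y) U y) : ℝ) ≤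
      if G.Adj z y then (b 0 : ℝ) - b 1 - 1 else (c 2 : ℝ) := by
    intro y hy
    simp only [hS, mem_erase, mem_filter, mem_univ, true_and] at hy
    have hsub : bipartiteBelow (fun u y => G.Adj u y) U y ⊆ G.commonNbrs z y := by
      intro u
      simp only [hU, mem_bipartiteBelow, mem_filter, mem_univ, true_and, mem_commonNbrs]
      exact fun hu => ⟨hu.1.1, hu.2.symm⟩
    split_ifs with hzy
    · rw [← h.card_commonNbrs_adj (by norm_num) hzy]
      exact_mod_cast card_le_card hsub
    · norm_cast
      by_cases h2 : G.dist z y = 2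
      · rw [← h.card_commonNbrs_two h2]
        exact card_le_card hsub
      · rw [card_eq_zero.mpr]
        · exact Nat.zero_le _
        refine eq_empty_of_forall_notMem fun u hu => ?_
        have hu' := mem_commonNbrs.mp (hsub hu)
        have h3 := (h.dist_adj_le z hu'.2).2
        rw [dist_eq_one_iff_adj.mpr hu'.1] at h3
        have h4 := h.connected.one_lt_dist_of_ne_of_not_adj (Ne.symm hy.1) hzy
        omega
  have hb2 := h.b_pos (show 2 < 3 by norm_num)
  have hcast : (c 3 : ℝ) * (b 2 - 1) =
      ∑ y ∈ S, (#(bipartiteBelow (fun u y => G.Adj u y) U y) : ℝ) := by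
    rw [← Nat.cast_sum, ← hcount]
    push_cast [Nat.cast_sub (show 1 ≤ b 2 from hb2)]
    rfl
  have hScard : (#S : ℝ) = (#{y | G.dist x y = 3} : ℝ) - 1 := by
    have hmem : z ∈ ({y | G.dist x y = 3} : Finset V) := by simp [hxz]
    rw [hS, card_erase_of_mem hmem, Nat.cast_sub (card_pos.mpr ⟨z, hmem⟩), Nat.cast_one]
  have hsplit : (#{y ∈ S | ¬ G.Adj z y} : ℝ) =
      (#{y | G.dist x y = 3} : ℝ) - 1 - ((b 0 : ℝ) - c 3) := by
    rw [← hScard, ← hadj, ← card_filter_add_card_filter_not (s := S) (fun y => G.Adj z y)]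
    push_cast
    ring
  rw [hcast]
  refine (sum_le_sum hright).trans_eq ?_
  rw [sum_ite, sum_const, sum_const, nsmul_eq_mul, nsmul_eq_mul, hadj, hsplit]

/-- In diameter three with `a 3 ≠ 0`, every neighbour `y` of `x` has a vertex at distance three
from both: the number of these does not depend on `y`, as the remaining vertices at distance three
from `x` are at distance two from `y`. -/
theorem b_zero_le_card_sphere_mul (h : G.HasIntersectionArray 3 b c) (ha : b 0 ≠ c 3) (x : V) :
    b 0 ≤ #{y | G.dist x y = 3} * (b 0 - c 3) := by
  have hcount := sum_card_bipartiteAbove_eq_sum_card_bipartiteBelow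
    (s := {y | G.Adj x y}) (t := {z | G.dist x z = 3}) (fun y z => G.dist z y = 3)
  have hright : ∀ z ∈ ({z | G.dist x z = 3} : Finset V),
      #(bipartiteBelow (fun y z => G.dist z y = 3) {y | G.Adj x y} z) = b 0 - c 3 := by
    intro z hz
    simp only [mem_filter, mem_univ, true_and] at hz
    have h1 := h.card_a (G.dist_comm.trans hz)
    rw [h.b_last] at h1
    rw [bipartiteBelow, filter_filter]
    omega
  rw [sum_const_nat hright] at hcount
  have hleft : ∀ y, G.Adj x y →
      (#(bipartiteAbove (fun y z => G.dist z y = 3) {z | G.dist x z = 3} y) +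
        #{z | G.dist y z = 2 ∧ G.dist x z = 3}) = #{z | G.dist x z = 3} := by
    intro y hy
    rw [← card_filter_add_card_filter_not (s := {z | G.dist x z = 3}) (fun z => G.dist z y = 3)]
    congr 2
    ext z
    simp only [mem_filter, mem_univ, true_and]
    have h1 := h.dist_adj_le z hy
    have h2 := h.dist_le z y
    rw [G.dist_comm (u := z) (v := x)] at h1
    rw [G.dist_comm (u := y) (v := z)]
    omega
  rw [← hcount, ← h.card_adj x]
  have hc2 := h.c_pos (show 1 + 1 ≤ 3 by norm_num)
  obtain ⟨y₀, hy₀, hpos⟩ : ∃ y ∈ ({y | G.Adj x y} : Finset V),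
      #(bipartiteAbove (fun y z => G.dist z y = 3) {z | G.dist x z = 3} y) ≠ 0 := by
    apply exists_ne_zero_of_sum_ne_zero
    rw [hcount]
    obtain ⟨z, hz⟩ := h.exists_dist x le_rfl
    have h1 := h.card_a hz
    exact Nat.mul_ne_zero (card_pos.mpr ⟨z, by simp [hz]⟩).ne' (by omega)
  rw [card_eq_sum_ones]
  refine sum_le_sum fun y hy => ?_
  simp only [mem_filter, mem_univ, true_and] at hy hy₀
  have h1 := h.card_two_step_mul (dist_eq_one_iff_adj.mpr hy)
  have h2 := h.card_two_step_mul (dist_eq_one_iff_adj.mpr hy₀)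
  have h3 := Nat.eq_of_mul_eq_mul_right hc2 (h1.trans h2.symm)
  have h4 := hleft y hy
  have h5 := hleft y₀ hy₀
  simp only [Nat.reduceAdd] at h3
  omega

end HasIntersectionArray
end SimpleGraph

/-! ### The classification in diameter three -/

namespace SimpleGraph
namespace HasIntersectionArray

/-- The numerical contradiction in diameter three for `a 3 = 0` and `b 2 ≥ 2`. All intersection
numbers are divided by the valency: `c`, `α`, `B`, `τ` stand for `c 2`, `a 1`, `b 2`, `1`, and
`t = b 1 / c 2`, `E = ε ^ 2`. The count `hcount` makes `c` exceed `α` by at least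
`(2 - t) / (2 t - 1)`, too much for the bound `hQ` on the squares of the eigenvalues. -/
theorem false_of_antipodal_bounds {t c α B τ E : ℝ} (ht : 1 ≤ t) (ht2 : t < 2) (hE0 : 0 < E)
    (hE : E ≤ (2 - t) ^ 2) (hτ0 : 0 < τ) (hτ : 800 * τ ≤ E ^ 2) (hα : α + t * c + τ = 1)
    (hc : 0 < c) (hB : 2 * τ ≤ B)
    (hQ : 28 * ((α - c) ^ 2 + 2 * B * c) ≤ E * (τ + t + t * B))
    (hcount : B - τ ≤ (t * B - τ) * c) : False := by
  have hE1 : E ≤ 1 := by nlinarith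
  have h1 : 1 ≤ (2 * t - 1) * c := by
    by_contra! hlt
    nlinarith [mul_nonneg (sub_nonneg.mpr ht) (sub_nonneg.mpr hB), mul_pos hτ0 hc]
  have h2 : 2 - t ≤ (2 * t - 1) * (c - α) := by nlinarith
  have h3 : (2 - t) ^ 2 ≤ (2 * t - 1) ^ 2 * (α - c) ^ 2 := by
    have : (2 - t) ^ 2 ≤ ((2 * t - 1) * (c - α)) ^ 2 := pow_le_pow_left₀ (by linarith) h2 2
    nlinarith
  have h4 : (2 - t) ^ 2 ≤ 9 * (α - c) ^ 2 := h3.trans (by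
    have : (2 * t - 1) ^ 2 ≤ 9 := by nlinarith
    exact mul_le_mul_of_nonneg_right this (sq_nonneg _))
  have h5 : t * B * E ≤ 56 * B * c := by
    have : E * t ≤ 56 * c := by nlinarith
    nlinarith
  have h6 : τ ≤ 1 / 800 := by nlinarith
  nlinarith


/-- In the notation of `false_of_non_antipodal_bounds`: `c` is bounded away from zero, as otherwise
`δ = α - c` is too large for `hQ`. -/
theorem three_tenths_le_of_bounds {t c γ B τ E r δ : ℝ} (ht : 1 ≤ t) (ht2 : t < 2) (hE0 : 0 < E)
    (hE : E ≤ (2 - t) ^ 2) (hτ1 : τ ≤ 1 / 800) (hEτ : E * τ ≤ τ) (hcδ : (1 + t) * c = 1 - τ - δ)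
    (hc : 0 < c) (hB : 0 < B) (hrt : r ≤ t ^ 2)
    (hQ : 28 * (δ ^ 2 + (1 - γ - B) ^ 2 + 2 * B * c) ≤ E * (τ + t + r)) : 3 / 10 ≤ c := by
  by_contra! hlt
  have h1 : 7 / 10 - 3 / 10 * t - τ ≤ δ := by
    have := mul_le_mul_of_nonneg_left hlt.le (show 0 ≤ 1 + t by linarith)
    linarith
  have h2 : (7 / 10 - 3 / 10 * t - 1 / 800) ^ 2 ≤ δ ^ 2 :=
    pow_le_pow_left₀ (by linarith) (by linarith) 2
  have h3 : 28 * δ ^ 2 ≤ E * (τ + t + t ^ 2) := by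
    have := mul_le_mul_of_nonneg_left hrt hE0.le
    nlinarith only [sq_nonneg (1 - γ - B), mul_pos hB hc, this, hQ]
  have h4 : E * (t + t ^ 2) ≤ (2 - t) ^ 2 * (t + t ^ 2) :=
    mul_le_mul_of_nonneg_right hE (by positivity)
  obtain ⟨v, rfl⟩ : ∃ v, t = 2 - v := ⟨2 - t, by ring⟩
  have h5 : 28 * (7 / 10 - 3 / 10 * (2 - v) - 1 / 800) ^ 2 ≤
    1 / 800 + v ^ 2 * ((2 - v) + (2 - v) ^ 2) := by linarith
  have hv0 : 0 < v := by linarith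
  nlinarith only [h5, hv0, mul_nonneg hv0.le (sq_nonneg (v - 435 / 1000)),
    mul_nonneg (pow_pos hv0 3).le (show 0 ≤ 1 - v by linarith)]

/-- In the notation of `false_of_non_antipodal_bounds`: the count forces `1 - γ` or `|δ|` to be
large, where `δ = α - c`. -/
theorem one_le_of_count_bounds {t c α γ B τ E r δ : ℝ} (ht : 1 ≤ t) (hE0 : 0 < E)
    (hτ0 : 0 < τ) (hτ : 800 * τ ≤ E ^ 2) (hδ : δ = α - c) (hcδ : (1 + t) * c = 1 - τ - δ)
    (hc : 0 < c) (hγ0 : 0 < γ) (hγ : γ ≤ 1) (hB : 0 < B) (hr : r * γ = t * B) (hr0 : 0 < r)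
    (hcount : γ * (B - τ) ≤ (1 - γ) * α + (r - τ - (1 - γ)) * c) (hr2 : τ ≤ r ^ 2)
    (hgr : 1 - γ ≤ r) :
    1 ≤ 2 * (1 + t) * (1 - γ) + t ^ 2 * |δ| + (1 + t) * (t * E) / 28 := by
  have ht0 : 0 < t := by linarith
  have h28 : 28 * τ ≤ r * E := by
    refine le_of_sq_le_sq ?_ (by positivity)
    have h1 := mul_le_mul_of_nonneg_left hr2 hτ0.le
    have h2 := mul_le_mul_of_nonneg_left hτ (sq_nonneg r)
    have h3 := mul_le_mul_of_nonneg_right hr2 hτ0.le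
    nlinarith only [h1, h2, h3, sq_nonneg τ]
  have h1 : 28 * (γ ^ 2 * τ) ≤ t * B * E := by
    have h2 := mul_le_mul_of_nonneg_left h28 (sq_nonneg γ)
    have h3 := mul_le_mul_of_nonneg_left hγ (show 0 ≤ t * B * E by positivity)
    linear_combination h2 + h3 + γ * E * hr
  have h2 : γ * (1 - γ) * δ ≤ t * B * max δ 0 := by
    have h3 : γ * (1 - γ) ≤ t * B := by
      rw [← hr, mul_comm r]; exact mul_le_mul_of_nonneg_left hgr hγ0.le
    calc γ * (1 - γ) * δ ≤ γ * (1 - γ) * max δ 0 :=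
          mul_le_mul_of_nonneg_left (le_max_left _ _)
            (mul_nonneg hγ0.le (sub_nonneg.mpr hγ))
      _ ≤ _ := mul_le_mul_of_nonneg_right h3 (le_max_right _ _)
  have h4 : γ ^ 2 * (B - τ) ≤ γ * (1 - γ) * δ + t * B * c := by
    have h5 := mul_le_mul_of_nonneg_left hcount hγ0.le
    have h6 : 0 ≤ γ * τ * c := by positivity
    rw [hδ]
    linear_combination h5 + h6 + c * hr
  have h7 : γ ^ 2 * B ≤ (t * E / 28 + t * (c + max δ 0)) * B := by linarith
  have h8 := le_of_mul_le_mul_right h7 hB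
  have h9 : (1 + t) * (c + max δ 0) ≤ 1 + t * |δ| := by
    rcases le_total δ 0 with h | h
    · rw [max_eq_right h, abs_of_nonpos h]
      nlinarith only [hcδ, mul_nonneg (sub_nonneg.mpr ht) (neg_nonneg.mpr h), hτ0]
    · rw [max_eq_left h, abs_of_nonneg h]
      linarith
  have h10 := mul_le_mul_of_nonneg_left h8 (show 0 ≤ 1 + t by linarith)
  have h11 := mul_le_mul_of_nonneg_left h9 ht0.le
  have h12 : (1 + t) * (1 - 2 * (1 - γ)) ≤ (1 + t) * γ ^ 2 :=
    mul_le_mul_of_nonneg_left (by nlinarith only [sq_nonneg (1 - γ)]) (by linarith)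
  linarith

/-- The numerical contradiction in diameter three for `a 3 ≠ 0`. All numbers are divided by the
valency: `c`, `α`, `γ`, `B`, `τ`, `r` stand for `c 2`, `a 1`, `c 3`, `b 2`, `1` and the number of
vertices at distance three from a vertex, and `t = b 1 / c 2`, `E = ε ^ 2`. The bound `hQ` on the
squares of the eigenvalues makes `α - c`, `B` and `1 - γ` small, while the count `hcount` forces
`γ ^ 2` to be at most about `t / (1 + t) ≤ 2 / 3`. -/
theorem false_of_non_antipodal_bounds {t c α γ B τ E r : ℝ} (ht : 1 ≤ t) (ht2 : t < 2) (hE0 : 0 < E)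
    (hE : E ≤ (2 - t) ^ 2) (hτ0 : 0 < τ) (hτ : 800 * τ ≤ E ^ 2) (hα : α + t * c + τ = 1)
    (hc : 0 < c) (hcγ : c ≤ γ) (hγ : γ ≤ 1) (hB : 0 < B) (hBt : B ≤ t * c) (hr : r * γ = t * B)
    (hQ : 28 * ((α - c) ^ 2 + (1 - γ - B) ^ 2 + 2 * B * c) ≤ E * (τ + t + r))
    (hcount : γ * (B - τ) ≤ (1 - γ) * α + (r - τ - (1 - γ)) * c) (hr2 : τ ≤ r ^ 2)
    (hgr : 1 - γ ≤ r) : False := by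
  have hγ0 : 0 < γ := hc.trans_le hcγ
  have ht0 : 0 < t := by linarith
  have hr0 : 0 < r := pos_of_mul_pos_left (hr ▸ mul_pos ht0 hB) hγ0.le
  have hE1 : E ≤ 1 := by nlinarith only [hE, ht, ht2]
  have hτ1 : τ ≤ 1 / 800 := by nlinarith only [hτ, hE1, hE0]
  have hrt : r ≤ t ^ 2 := by
    refine le_of_mul_le_mul_right ?_ hγ0
    have := mul_le_mul_of_nonneg_left (hBt.trans (mul_le_mul_of_nonneg_left hcγ ht0.le)) ht0.le
    linarith
  obtain ⟨δ, hδ⟩ : ∃ δ, δ = α - c := ⟨_, rfl⟩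
  rw [← hδ] at hQ
  have hcδ : (1 + t) * c = 1 - τ - δ := by rw [hδ]; linarith
  have hEτ : E * τ ≤ τ := mul_le_of_le_one_left hτ0.le hE1
  have hc3 : 3 / 10 ≤ c := three_tenths_le_of_bounds ht ht2 hE0 hE hτ1 hEτ hcδ hc hB hrt hQ
  have key := one_le_of_count_bounds ht hE0 hτ0 hτ hδ hcδ hc hγ0 hγ hB hr hr0 hcount hr2 hgr
  have htv : t * (2 - t) ≤ 1 := by nlinarith only [sq_nonneg (t - 1)]
  have htv0 : 0 ≤ t * (2 - t) := mul_nonneg ht0.le (by linarith)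
  have hEt : E * t ≤ 2 * t - t ^ 2 := by
    have h1 := mul_le_mul_of_nonneg_right hE ht0.le
    nlinarith only [h1, htv0, ht]
  have hEtt : E * t ^ 2 ≤ 2 * t - t ^ 2 := by
    have h1 := mul_le_mul_of_nonneg_right hE (sq_nonneg t)
    nlinarith only [h1, htv0, htv]
  have hr3 : E * r ≤ 10 / 3 * B := by
    have h2 : r * (3 / 10) ≤ t * B := by
      rw [← hr]; exact mul_le_mul_of_nonneg_left (hc3.trans hcγ) hr0.le
    have h3 := mul_le_mul_of_nonneg_left h2 hE0.le
    have h4 := mul_le_mul_of_nonneg_right (show E * t ≤ 1 by linarith) hB.le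
    linarith
  have hu : 28 * (δ ^ 2 + (1 - γ - B) ^ 2 + 12 / 25 * B) ≤ 1 / 800 + E * t := by
    have := mul_le_mul_of_nonneg_left hc3 hB.le
    linarith
  -- Arithmetic-geometric means, in the form `2 (1 + t) u ≤ 11 t u² + (1 + t)² / (11 t)` for
  -- `u = 1 - γ - B` and `t² |δ| ≤ 11 t δ² + t³ / 44`, reduce `key` and `hu` to an inequality in `t`
  -- that fails on `[1, 2]`.
  have h1 := sq_nonneg (11 * t * (1 - γ - B) - (1 + t))
  have h2 := sq_nonneg (22 * t * |δ| - t ^ 2)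
  have h3 := mul_le_mul_of_nonneg_left key ht0.le
  have h4 := mul_le_mul_of_nonneg_left hu (sq_nonneg t)
  have h5 := mul_le_mul_of_nonneg_left hEtt ht0.le
  have h6 : 0 ≤ B * t * (82 / 25 * t - 2) := mul_nonneg (by positivity) (by linarith)
  have h7 : |δ| ^ 2 = δ ^ 2 := sq_abs δ
  have h8 := mul_le_mul_of_nonneg_left hEtt (show 0 ≤ 1 + t by linarith)
  have h9 : 11 * t ≤ (1 + t) ^ 2 + t ^ 4 / 4 + 121 / 28 * (t ^ 2 / 800 + t * (2 * t - t ^ 2)) +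
      11 / 28 * (1 + t) * (2 * t - t ^ 2) := by
    linear_combination 11 * h3 + h1 + h2 / 4 + 121 / 28 * h4 + 121 / 28 * h5 + 11 / 28 * h8 +
      11 * h6 + 121 * t ^ 2 * h7
  obtain ⟨s, rfl⟩ : ∃ s, t = 1 + s := ⟨t - 1, by ring⟩
  have hs0 : 0 ≤ s := by linarith
  have hs1 : 0 ≤ 1 - s := by linarith
  nlinarith only [h9, hs0, hs1, mul_nonneg hs0 hs1, mul_nonneg (mul_nonneg hs0 hs1) hs0,
    mul_nonneg (mul_nonneg hs0 hs1) (sq_nonneg s)]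

variable {V : Type u} [Fintype V] [DecidableEq V] {G : SimpleGraph V} [DecidableRel G.Adj]
  {D : ℕ} {b c : ℕ → ℕ}

/-- In diameter three, if the valency is large and `b 1 ≤ (2 - ε) c 2`, a non-bipartite graph is a
Taylor graph: the eigenvalue bound `mul_sum_sq_le` and the count `c_three_mul_le` contradict each
other unless `a 3 = 0` and `b 2 = 1`. -/
theorem isTaylor_of_not_isBipartite (h : G.HasIntersectionArray 3 b c) (hnb : ¬ G.IsBipartite)
    {ε : ℝ} (hε : 0 < ε) (hb : (b 1 : ℝ) ≤ (2 - ε) * c 2) (hbig : 800 ≤ b 0 * ε ^ 4) :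
    G.IsTaylor := by
  obtain ⟨x⟩ := h.connected.nonempty
  obtain ⟨z, hz⟩ := h.exists_dist x le_rfl
  obtain ⟨y, hy⟩ := h.exists_dist x (show 2 ≤ 3 by norm_num)
  set K := #{y | G.dist x y = 3} with hK
  have hk0 : 0 < b 0 := h.b_pos (by norm_num)
  have hb2 : 0 < b 2 := h.b_pos (by norm_num)
  have hc2 : 0 < c 2 := h.c_pos (show 1 + 1 ≤ 3 by norm_num)
  have hc21 : c 2 ≤ b 1 := h.c_le_b (by norm_num)
  have hb21 : b 2 ≤ b 1 := h.b_succ_le_b (by norm_num)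
  have hc23 : c 2 ≤ c 3 := h.c_le_c (by norm_num)
  have hc1 : c 1 = 1 := h.c_one (by norm_num)
  have h3k : c 3 ≤ b 0 := (Nat.le_add_left _ _).trans (h.b_add_c_le hz)
  have hk2 := h.card_sphere_mul x 1
  have hk3 := h.card_sphere_mul x 2
  rw [h.card_sphere_one] at hk2
  simp only [Nat.reduceAdd, ← hK] at hk2 hk3
  have hKpos : 0 < K := card_pos.mpr ⟨z, by simp [hz]⟩
  have hV := h.card_eq_add_card_sphere x
  rw [← hK] at hV
  set K₂ := #{y | G.dist x y = 2} with hK₂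
  have hcount := h.c_three_mul_le hz
  rw [← hK] at hcount
  have hKa : b 0 - c 3 + 1 ≤ K := by
    have h1 := h.card_a hz
    rw [h.b_last] at h1
    have h2 : insert z ({w | G.Adj z w ∧ G.dist x w = 3} : Finset V) ⊆
        ({y | G.dist x y = 3} : Finset V) := by
      intro w
      simp only [mem_insert, mem_filter, mem_univ, true_and]
      rintro (rfl | hw)
      exacts [hz, hw.2]
    have h3 := card_le_card h2
    rw [card_insert_of_notMem (by simp), ← hK] at h3
    omega
  -- the sum of squares of the three non-trivial eigenvalues, with `28 ^ 2 ≤ 800`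
  have hε2 : 0 < ε ^ 2 := by positivity
  have hQ := h.mul_sum_sq_le hnb (N := 28 / ε ^ 2) (by
    rw [div_pow, div_le_iff₀ (by positivity)]
    linarith)
  rw [hV, div_mul_eq_mul_div, div_le_iff₀ hε2] at hQ
  push_cast at hQ
  have hkR : (0 : ℝ) < b 0 := by exact_mod_cast hk0
  have hcR : (0 : ℝ) < c 2 := by exact_mod_cast hc2
  have hc21R : (c 2 : ℝ) ≤ b 1 := by exact_mod_cast hc21
  have hb21R : (b 2 : ℝ) ≤ b 1 := by exact_mod_cast hb21
  have hc23R : (c 2 : ℝ) ≤ c 3 := by exact_mod_cast hc23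
  have h3kR : (c 3 : ℝ) ≤ b 0 := by exact_mod_cast h3k
  have hb2R : (0 : ℝ) < b 2 := by exact_mod_cast hb2
  have hk2R : (b 0 : ℝ) * b 1 = K₂ * c 2 := by exact_mod_cast hk2
  have hk3R : (K₂ : ℝ) * b 2 = K * c 3 := by exact_mod_cast hk3
  -- all intersection numbers as multiples of the valency
  obtain ⟨k, hk⟩ : ∃ k : ℝ, k = b 0 := ⟨_, rfl⟩
  obtain ⟨t, ht⟩ : ∃ t : ℝ, (b 1 : ℝ) = t * c 2 := ⟨b 1 / c 2, by field_simp⟩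
  obtain ⟨γ₂, h2⟩ : ∃ s : ℝ, (c 2 : ℝ) = k * s := ⟨c 2 / k, by rw [hk]; field_simp⟩
  obtain ⟨γ₃, h3⟩ : ∃ s : ℝ, (c 3 : ℝ) = k * s := ⟨c 3 / k, by rw [hk]; field_simp⟩
  obtain ⟨β, h4⟩ : ∃ s : ℝ, (b 2 : ℝ) = k * s := ⟨b 2 / k, by rw [hk]; field_simp⟩
  obtain ⟨r, h5⟩ : ∃ s : ℝ, (K : ℝ) = k * s := ⟨K / k, by rw [hk]; field_simp⟩
  obtain ⟨τ, h6⟩ : ∃ s : ℝ, (1 : ℝ) = k * s := ⟨1 / k, by rw [hk]; field_simp⟩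
  have ht1 : 1 ≤ t := by
    rw [ht] at hc21R
    exact le_of_mul_le_mul_right (by linarith) hcR
  have htε : t ≤ 2 - ε := by
    rw [ht] at hb
    exact le_of_mul_le_mul_right hb hcR
  have h7 : (K₂ : ℝ) = k * t := by
    refine mul_right_cancel₀ hcR.ne' ?_
    rw [← hk2R, ht, hk]; ring
  rw [← hk] at hkR h3kR hQ hcount hbig
  have hE : ε ^ 2 ≤ (2 - t) ^ 2 := pow_le_pow_left₀ hε.le (by linarith) 2
  have hτ0 : 0 < τ := pos_of_mul_pos_right (h6 ▸ one_pos) hkR.le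
  have hτ : 800 * τ ≤ (ε ^ 2) ^ 2 := by
    refine le_of_mul_le_mul_left ?_ hkR
    linarith
  have hγ₂ : 0 < γ₂ := pos_of_mul_pos_right (h2 ▸ hcR) hkR.le
  have hβ : 0 < β := pos_of_mul_pos_right (h4 ▸ hb2R) hkR.le
  have hγ₂₃ : γ₂ ≤ γ₃ := le_of_mul_le_mul_left (by rwa [← h2, ← h3]) hkR
  have hγ₃ : γ₃ ≤ 1 := le_of_mul_le_mul_left (by rw [← h3]; linarith) hkR
  have hβt : β ≤ t * γ₂ := by
    refine le_of_mul_le_mul_left ?_ hkR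
    rw [← h4, mul_left_comm, ← h2, ← ht]
    exact hb21R
  have hr : r * γ₃ = t * β := by
    refine mul_left_cancel₀ (pow_ne_zero 2 hkR.ne') ?_
    rw [h7, h4, h5, h3] at hk3R
    linear_combination -hk3R
  obtain ⟨α, hα⟩ : ∃ α : ℝ, α + t * γ₂ + τ = 1 := ⟨1 - t * γ₂ - τ, by ring⟩
  have hα' : k - b 1 - 1 = k * α := by
    rw [ht, h2, h6]
    linear_combination -k * hα
  have hcount' : γ₃ * (β - τ) ≤ (1 - γ₃) * α + (r - τ - (1 - γ₃)) * γ₂ := by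
    refine le_of_mul_le_mul_left ?_ (pow_pos hkR 2)
    rw [hα', h2, h3, h4, h5, h6] at hcount
    linarith
  have hQ' : 28 * ((α - γ₂) ^ 2 + (1 - γ₃ - β) ^ 2 + 2 * β * γ₂) ≤ ε ^ 2 * (τ + t + r) := by
    refine le_of_mul_le_mul_left ?_ (pow_pos hkR 2)
    have h8 : 0 ≤ k - c 2 := by linarith
    rw [show (1 : ℝ) + k + K₂ + K - k = 1 + K₂ + K by ring, h7, h5, hα'] at hQ
    have h9 : k * (1 + k * t + k * r) = k ^ 2 * (τ + t + r) := by
      linear_combination k * h6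
    rw [h9] at hQ
    rw [h3, h4] at hQ
    have h10 : (k * α - c 2) ^ 2 + (k - k * γ₃ - k * β) ^ 2 + 2 * (k * β * c 2) =
        k ^ 2 * ((α - γ₂) ^ 2 + (1 - γ₃ - β) ^ 2 + 2 * β * γ₂) := by
      rw [h2]; ring
    linarith
  by_cases ha : b 0 = c 3
  · have hγ1 : γ₃ = 1 := by
      refine mul_left_cancel₀ hkR.ne' ?_
      rw [← h3, hk, ha, mul_one]
    rcases Nat.lt_or_ge 1 (b 2) with hlt | hle
    · exfalso
      subst hγ1
      have hβ2 : 2 * τ ≤ β := by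
        refine le_of_mul_le_mul_left ?_ hkR
        have : (2 : ℝ) ≤ b 2 := by exact_mod_cast hlt
        linarith
      rw [mul_one] at hr
      subst hr
      refine false_of_antipodal_bounds ht1 (by linarith) hε2 hE hτ0 hτ hα hγ₂ hβ2 ?_ ?_
      · nlinarith only [hQ', sq_nonneg β]
      · linarith
    · have hb2' : b 2 = 1 := by omega
      have hK1 : K = 1 := by
        have h8 : (K : ℝ) * k = t * k := by
          rw [hb2', h7, ← ha, ← hk] at hk3R
          push_cast at hk3R
          linarith
        have h9 := mul_right_cancel₀ hkR.ne' h8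
        have h10 : (K : ℝ) < 2 := by linarith
        have h11 : K < 2 := by exact_mod_cast h10
        omega
      have hb1 : c 2 = b 1 := by
        rw [hK1, hb2', ← ha] at hk3
        have h8 : K₂ = b 0 := by omega
        rw [h8] at hk2
        exact (Nat.eq_of_mul_eq_mul_left hk0 hk2).symm
      exact ⟨b 0, b 1, b, c, h, rfl, rfl, hb2', hc1, hb1, ha.symm⟩
  · exfalso
    refine false_of_non_antipodal_bounds ht1 (by linarith) hε2 hE hτ0 hτ hα hγ₂ hγ₂₃ hγ₃ hβ hβt
      hr hQ' hcount' ?_ ?_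
    · have h8 := h.b_zero_le_card_sphere_mul ha x
      rw [← hK] at h8
      have h9 : b 0 ≤ K * K := h8.trans (Nat.mul_le_mul_left _ (by omega))
      have h10 : k ≤ (K : ℝ) * K := by rw [hk]; exact_mod_cast h9
      rw [h5] at h10
      refine le_of_mul_le_mul_left ?_ (pow_pos hkR 2)
      linear_combination h10 - k * h6
    · have h8 : b 0 ≤ K + c 3 := by omega
      have h9 : (b 0 : ℝ) ≤ K + c 3 := by exact_mod_cast h8
      rw [← hk, h5, h3] at h9
      exact le_of_mul_le_mul_left (by linarith) hkR

end HasIntersectionArray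

/-- The hypothesis on the number of vertices at distance two reads `b 1 ≤ (2 - ε) c 2`, and forces
`ε ≤ 1` because `c 2 ≤ b 1`. -/
theorem isValencyThreshold_of_pos {ε : ℝ} (hε : 0 < ε) :
    IsValencyThreshold.{u} ε ((40 / ε ^ 2 - 1) * (40 / ε ^ 2 + 2) / 2) := by
  classical
  intro V _ G D b c h hD hκ x hx
  have := Fintype.ofFinite V
  have hk0 : 0 < b 0 := h.b_pos (by omega)
  have hc2 : 0 < c 2 := h.c_pos (show 1 + 1 ≤ D by omega)
  have hkR : (0 : ℝ) < b 0 := by exact_mod_cast hk0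
  have hcR : (0 : ℝ) < c 2 := by exact_mod_cast hc2
  have hx' : (#{y | G.dist x y = 2} : ℝ) ≤ (2 - ε) * b 0 := by
    convert hx using 2
    rw [Set.ncard_eq_toFinset_card']
    congr 1
    ext y
    rw [Set.mem_toFinset]
    simp [distSphere]
  have hk2 := h.card_sphere_mul x 1
  rw [h.card_sphere_one] at hk2
  have hk2R : (b 0 : ℝ) * b 1 = #{y | G.dist x y = 2} * c 2 := by exact_mod_cast hk2
  have hb : (b 1 : ℝ) ≤ (2 - ε) * c 2 := by
    refine le_of_mul_le_mul_left ?_ hkR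
    rw [hk2R]
    have := mul_le_mul_of_nonneg_right hx' hcR.le
    linarith
  have hcb : (c 2 : ℝ) ≤ b 1 := by exact_mod_cast h.c_le_b (show 2 + 1 ≤ D by omega)
  have hε1 : ε ≤ 1 := by
    by_contra! hlt
    nlinarith only [hlt, hcR, hb, hcb]
  -- `(M - 1) (M + 2) / 2 ≥ M ^ 2 / 2 = 800 / ε ^ 4` for `M = 40 / ε ^ 2 ≥ 2`
  have hbig : 800 ≤ b 0 * ε ^ 4 := by
    have h1 : 2 ≤ 40 / ε ^ 2 := by
      rw [le_div_iff₀ (by positivity)]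
      nlinarith only [hε, hε1]
    have h2 : (40 / ε ^ 2) ^ 2 / 2 ≤ b 0 := by linarith
    have h3 : (40 / ε ^ 2) ^ 2 / 2 * ε ^ 4 = 800 := by field_simp; norm_num
    rw [← h3]
    exact mul_le_mul_of_nonneg_right h2 (by positivity)
  have hD3 : D = 3 := by
    have := h.diam_lt_four hε hb hbig
    omega
  subst hD3
  exact ⟨rfl, or_iff_not_imp_left.mpr fun hnb => h.isTaylor_of_not_isBipartite hnb hε hb hbig⟩

end SimpleGraph

theorem theorem12 (ε : ℝ) (hε : 0 < ε) :
    (∃ κ : ℝ, 3 ≤ κ ∧ SimpleGraph.IsValencyThreshold.{u} ε κ) ∧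
    SimpleGraph.IsValencyThreshold.{u} ε ((40 / ε ^ 2 - 1) * (40 / ε ^ 2 + 2) / 2) ∧
    (ε ≤ 2 → 3 ≤ (40 / ε ^ 2 - 1) * (40 / ε ^ 2 + 2) / 2) := by
  have h := SimpleGraph.isValencyThreshold_of_pos.{u} hε
  refine ⟨⟨max 3 _, le_max_left _ _, fun V _ G D b c hG hD hκ =>
    h V G D b c hG hD ((le_max_right _ _).trans hκ)⟩, h, fun hε2 => ?_⟩
  have h1 : 10 ≤ 40 / ε ^ 2 := by
    rw [le_div_iff₀ (by positivity)]
    nlinarith only [hε, hε2]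
  nlinarith only [h1]
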